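/- **Closed form of the single layer integral for two triangles with a common edge.** *The integrals.* Let $p,u,v,w\in\mathbb R^3$, let $\pi=\{(x_1,x_2): 0<x_1<1,\ 0<x_2<x_1\}$, and let $$\chi_\tau(y)=p+y_1v+y_2u,\qquad \chi_\sigma(x)=p+x_1v+x_2w,\qquad \tau=\chi_\tau(\pi),\quad \sigma=\chi_\sigma(\pi),$$ so that $\tau$ and $\sigma$ are the open flat triangles with vertices $p,\,p+v,\,p+v+u$ and $p,\,p+v,\,p+v+w$. Put $g_\tau=\sqrt{\det(J_\tau^\top J_\tau)}$, $J_\tau=(v\mid u)$, and $g_\sigma=\sqrt{\det(J_\sigma^\top J_\sigma)}$, $J_\sigma=(v\mid w)$. Assume $g_\tau\ne0$, $g_\sigma\neq 0$ and that the closed triangles intersect exactly in the edge from $p$ to $p+v$, i.e. $\bar\tau\cap\bar\sigma=[p,p+v]$. Let $$I=\int_\sigma\int_\tau\frac{1}{4\pi|y-x|}\,dS(y)\,dS(x)$$ and $$I_1=\int_{(0,1)^2}\frac{d(\eta_3,\eta_4)}{|\eta_3(u+v)+\eta_4w-u|},\qquad I_2=\int_{(0,1)^2}\frac{\eta_3\,d(\eta_3,\eta_4)}{|\eta_4\eta_3(u+v)-\eta_3u+w|},\qquad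 I_3=\int_{(0,1)^2}\frac{\eta_3\,d(\eta_3,\eta_4)}{|\eta_4\eta_3(w+v)-\eta_3w+u|},$$ $$I_4=\int_{(0,1)^2}\frac{\eta_3\,d(\eta_3,\eta_4)}{|\eta_4\eta_3u+\eta_3(w+v)-w|},\qquad I_5=\int_{(0,1)^2}\frac{\eta_3\,d(\eta_3,\eta_4)}{|\eta_4\eta_3(w+v)+\eta_3u-w|}.$$ *The integral $H$ and its closed form $\mathcal H$.* For $a,b,c\in\mathbb R^3$ with $c\ne0$ let $\hat c=c/|c|$, $$h(\eta)=\frac{(\eta a+b)\cdot b+|\eta a+b|\;b\cdot\hat c}{|\eta a+b|^2+|\eta a+b|\,(\eta a+b)\cdot\hat c},\qquad H(a,b,c)=\int_0^1h(\eta)\,d\eta .$$ Call $(a,b,c)$ *regular* if $|\eta a+b|+(\eta a+b)\cdot\hat c\ne0$ for all $\eta\in(0,1]$, i.e. if the denominator of $h$ has no zero in $(0,1]$. Define $\mathcal H(a,b,c)$ as follows. If $a=0$, then $\mathcal H=1$. If $a\ne0$, put $p=a\cdot b/|a|^2$ and $q=\sqrt{|b|^2/|a|^2-p^2}$ (here $p$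 is a number). If $q=0$, then $\mathcal H=p\ln(1+1/p)$ (to be read as $0$ if $p=0$). If $q>0$, put $$\begin{aligned} \alpha_0&=q|a|+(b-pa)\cdot\hat c,&\alpha_1&=2q\,a\cdot\hat c,&\alpha_2&=q|a|+(pa-b)\cdot\hat c,\\ \beta_0&=b\cdot\hat c+q|a|,&\beta_1&=2p|a|,&\beta_2&=b\cdot\hat c-q|a|,\\ \gamma_1&=\tfrac12\,\frac{\beta_0+\beta_1+\beta_2}{\alpha_0+\alpha_1+\alpha_2},&\gamma_2&=\tfrac12\,\frac{\beta_0-\beta_1+\beta_2}{\alpha_0-\alpha_1+\alpha_2},&\gamma_3&=\beta_0-(\gamma_1+\gamma_2)\alpha_0,\quad\gamma_4=\alpha_2(\gamma_1-\gamma_2), \end{aligned}$$ where $\gamma_1$ (resp. $\gamma_2$) is set to $0$ if its denominator vanishes, let $D=4\alpha_0\alpha_2-\alpha_1^2$, $$F(t)=\gamma_2\ln|1+t|-\gamma_1\ln|1-t|,$$ $$G(t)=\begin{cases}\dfrac{\gamma_4}{2\alpha_2}\ln|\alpha_0+\alpha_1t+\alpha_2t^2|+\dfrac{2\gamma_3\alpha_2-\gamma_4\alpha_1}{\alpha_2\sqrt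 D}\arctan\dfrac{\alpha_1+2\alpha_2t}{\sqrt D},&D>0,\\[2ex] \dfrac{\gamma_4}{\alpha_2}\ln\Big|t+\dfrac{\alpha_1}{2\alpha_2}\Big|-\dfrac{2\gamma_3\alpha_2-\gamma_4\alpha_1}{\alpha_2(2\alpha_2t+\alpha_1)},&D=0,\end{cases}$$ where $G$ is set to $0$ if $\alpha_2=0$ or if $\gamma_3=\gamma_4=0$, and $$t_0=\frac{p}{q+\sqrt{p^2+q^2}},\qquad t_1=\frac{p+1}{q+\sqrt{(p+1)^2+q^2}},\qquad \mathcal H(a,b,c)=2q\,\big(F(t_1)-F(t_0)+G(t_1)-G(t_0)\big).$$ *The formulas for $I_j$.* Let $(a_j,b_j,c_j)$ be given by | $j$ | $a_j$ | $b_j$ | $c_j$ | |---|---|---|---| | $1$ | $w$ | $v$ | $u+v$ | | $2$ | $v$ | $w$ | $u+v$ | | $3$ | $v$ | $u$ | $w+v$ | | $4$ | $u+v+w$ | $-w$ | $u$ | | $5$ | $u+v+w$ | $-w$ | $v+w$ | and let $(a_1',b_1')=(a_1,b_1-c_1)$ and $(a_j',b_j')=(a_j-c_j,b_j)$ for $j=2,\dots,5$.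 For $K\in\{H,\mathcal H\}$ consider the formula $$I_j=\frac1{|c_j|}\ln\frac{|a_j+b_j||c_j|+(a_j+b_j)\cdot c_j}{|a_j+b_j-c_j||c_j|+(a_j+b_j-c_j)\cdot c_j}-\frac1{|c_j|}\Big(K(a_j',b_j',c_j)-K(a_j,b_j,c_j)\Big).\tag{$*$}$$ **Statement.** 1. For all $a,b,c\in\mathbb R^3$ with $c\ne0$: if $a\neq0$ then $D\ge0$; and if $(a,b,c)$ is regular, then $h$ is integrable on $(0,1)$ and $H(a,b,c)=\mathcal H(a,b,c)$. 2. For two triangles as above, the kernel $1/(4\pi|y-x|)$ is integrable on $\sigma\times\tau$, the five integrands of $I_1,\dots,I_5$ are integrable on $(0,1)^2$, and $$I=\frac{g_\tau g_\sigma}{24\pi}\sum_{j=1}^5I_j .$$ 3. For two triangles as above and every $j\in\{1,\dots,5\}$ for which numerator and denominator under the logarithm in $(*)$ are positive, $(*)$ holds with $K=\mathcal H$. They are positive for all $j$ unless $p$ lies on the segment joining the two opposite vertices $p+v+u$ and $p+v+w$. 4. For two triangles as above and every $j$ for which $(a_j,b_j,c_j)$ and $(a_j',b_j',c_j)$ are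 regular, $(*)$ holds with $K=H$. This is the case for all $j$ if $u,v,w$ are linearly independent, i.e. if the triangles are not coplanar. -/

import Mathlib

open MeasureTheory

namespace SingleLayerEdge

noncomputable section

/-- Euclidean three-space. -/
abbrev E3 : Type := EuclideanSpace ℝ (Fin 3)

/-- The reference triangle `{0 < x₁ < 1, 0 < x₂ < x₁}`. -/
def refTriangle : Set (ℝ × ℝ) := {x | 0 < x.1 ∧ x.1 < 1 ∧ 0 < x.2 ∧ x.2 < x.1}

/-- The reference mapping `χ(x) = p + x₁ e + x₂ f`. -/
def chi (p e f : E3) (x : ℝ × ℝ) : E3 := p + x.1 • e + x.2 • f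

/-- The (open, flat) triangle with vertices `p`, `p + e`, `p + e + f`. -/
def triangle (p e f : E3) : Set E3 := chi p e f '' refTriangle

/-- The corresponding closed triangle. -/
def closedTriangle (p e f : E3) : Set E3 := convexHull ℝ {p, p + e, p + e + f}

/-- The Jacobian `J = (e | f)` of the reference mapping. -/
def jacobian (e f : E3) : Matrix (Fin 3) (Fin 2) ℝ := Matrix.of fun i k => ![e i, f i] k

/-- The Gram determinant `g = √(det(Jᵀ J))` of the reference mapping. -/
def gramRoot (e f : E3) : ℝ := √((jacobian e f).transpose * jacobian e f).det

/-- The fundamental solution of the Laplace operator. -/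
def fundSol (x y : E3) : ℝ := 1 / (4 * Real.pi * ‖y - x‖)

/-- `∫_σ ∫_τ u*(x, y) dS(y) dS(x)`, the surface measure `dS` being the two-dimensional
Hausdorff measure, normalised to agree with Lebesgue measure on Euclidean planes. -/
def singleLayer (σ τ : Set E3) : ℝ :=
  ∫ x in σ, (∫ y in τ, fundSol x y ∂(μHE[2] : Measure E3)) ∂(μHE[2] : Measure E3)

/-- The five integrands on `(0,1)²` of the regularised integral; the point is `(η₃, η₄)` and the
index `j : Fin 5` stands for the `(j+1)`-st integral. -/
def edgeIntegrand (u v w : E3) (j : Fin 5) (z : ℝ × ℝ) : ℝ :=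
  ![1 / ‖z.1 • (u + v) + z.2 • w - u‖,
    z.1 / ‖(z.2 * z.1) • (u + v) - z.1 • u + w‖,
    z.1 / ‖(z.2 * z.1) • (w + v) - z.1 • w + u‖,
    z.1 / ‖(z.2 * z.1) • u + z.1 • (w + v) - w‖,
    z.1 / ‖(z.2 * z.1) • (w + v) + z.1 • u - w‖] j

/-- The open unit square. -/
def unitSquare : Set (ℝ × ℝ) := Set.Ioo 0 1 ×ˢ Set.Ioo 0 1

/-- The integrals `I₁, …, I₅`. -/
def edgeIntegral (u v w : E3) (j : Fin 5) : ℝ := ∫ z in unitSquare, edgeIntegrand u v w j z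

/-! ### The integrand `h` and the function `H` -/

/-- `ĉ = c / |c|`. -/
def hat (c : E3) : E3 := ‖c‖⁻¹ • c

/-- The integrand `h(η)` with parameters `a, b, c`. -/
def hFun (a b c : E3) (η : ℝ) : ℝ :=
  (inner ℝ (η • a + b) b + ‖η • a + b‖ * inner ℝ b (hat c)) /
    (‖η • a + b‖ ^ 2 + ‖η • a + b‖ * inner ℝ (η • a + b) (hat c))

/-- `H(a, b, c) = ∫₀¹ h(η) dη`. -/
def hIntegral (a b c : E3) : ℝ := ∫ η in (0 : ℝ)..1, hFun a b c η

/-- No point `η a + b` with `0 < η ≤ 1` lies on the ray `{-t c : t ≥ 0}`; equivalently, the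
denominator of `h` has no zero in `(0, 1]`. -/
def Regular (a b c : E3) : Prop :=
  ∀ η ∈ Set.Ioc (0 : ℝ) 1, ‖η • a + b‖ + inner ℝ (η • a + b) (hat c) ≠ 0

/-! ### The closed form of `H` -/

def pPar (a b : E3) : ℝ := inner ℝ a b / ‖a‖ ^ 2

def qPar (a b : E3) : ℝ := √(‖b‖ ^ 2 / ‖a‖ ^ 2 - pPar a b ^ 2)

def alpha0 (a b c : E3) : ℝ := qPar a b * ‖a‖ + inner ℝ (-(pPar a b • a) + b) (hat c)

def alpha1 (a b c : E3) : ℝ := 2 * qPar a b * inner ℝ a (hat c)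

def alpha2 (a b c : E3) : ℝ := qPar a b * ‖a‖ + inner ℝ (pPar a b • a - b) (hat c)

def beta0 (a b c : E3) : ℝ := inner ℝ b (hat c) + qPar a b * ‖a‖

def beta1 (a b : E3) : ℝ := 2 * pPar a b * ‖a‖

def beta2 (a b c : E3) : ℝ := inner ℝ b (hat c) - qPar a b * ‖a‖

/-- In the degenerate case `α₀ + α₁ + α₂ = 0` the numerator vanishes as well and the coefficient
is `0` by the convention `x / 0 = 0`; the partial fraction decomposition stays correct. -/
def gamma1 (a b c : E3) : ℝ :=
  1 / 2 * ((beta0 a b c + beta1 a b + beta2 a b c) / (alpha0 a b c + alpha1 a b c + alpha2 a b c))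

/-- As for `gamma1`, the value is `0` in the degenerate case `α₀ - α₁ + α₂ = 0`. -/
def gamma2 (a b c : E3) : ℝ :=
  1 / 2 * ((beta0 a b c - beta1 a b + beta2 a b c) / (alpha0 a b c - alpha1 a b c + alpha2 a b c))

def gamma3 (a b c : E3) : ℝ := beta0 a b c - (gamma1 a b c + gamma2 a b c) * alpha0 a b c

def gamma4 (a b c : E3) : ℝ := alpha2 a b c * (gamma1 a b c - gamma2 a b c)

/-- The discriminant `D = 4 α₀ α₂ - α₁²`. -/
def disc (a b c : E3) : ℝ := 4 * alpha0 a b c * alpha2 a b c - alpha1 a b c ^ 2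

/-- Anti-derivative of `γ₁ / (1 - t) + γ₂ / (1 + t)`. -/
def antiF (a b c : E3) (t : ℝ) : ℝ :=
  gamma2 a b c * Real.log |1 + t| - gamma1 a b c * Real.log |1 - t|

/-- Anti-derivative of `(γ₃ + γ₄ t) / (α₀ + α₁ t + α₂ t²)`. The numerator is identically zero,
and `antiF` alone is the anti-derivative, if `α₂ = 0` or if `γ₃ = γ₄ = 0`; `G = 0` then. -/
def antiG (a b c : E3) (t : ℝ) : ℝ :=
  if alpha2 a b c = 0 ∨ (gamma3 a b c = 0 ∧ gamma4 a b c = 0) then 0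
  else if 0 < disc a b c then
    gamma4 a b c / (2 * alpha2 a b c) *
        Real.log |alpha0 a b c + alpha1 a b c * t + alpha2 a b c * t ^ 2| +
      (2 * gamma3 a b c * alpha2 a b c - gamma4 a b c * alpha1 a b c) /
          (alpha2 a b c * √(disc a b c)) *
        Real.arctan ((alpha1 a b c + 2 * alpha2 a b c * t) / √(disc a b c))
  else
    gamma4 a b c / alpha2 a b c * Real.log |t + alpha1 a b c / (2 * alpha2 a b c)| -
      (2 * gamma3 a b c * alpha2 a b c - gamma4 a b c * alpha1 a b c) /
        (alpha2 a b c * (2 * alpha2 a b c * t + alpha1 a b c))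

/-- `t₀`. -/
def tZero (a b : E3) : ℝ := pPar a b / (qPar a b + √(pPar a b ^ 2 + qPar a b ^ 2))

/-- `t₁`. -/
def tOne (a b : E3) : ℝ :=
  (pPar a b + 1) / (qPar a b + √((pPar a b + 1) ^ 2 + qPar a b ^ 2))

open Classical in
/-- The closed form of `H(a, b, c)`. For `a = 0` (where `p`, `q` are undefined) `h` is constantly
`1`. For `q = 0 = p`, that is `b = 0`, the value of `p ln(1 + 1/p)` is `0`. -/
def hClosed (a b c : E3) : ℝ :=
  if a = 0 then 1
  else if qPar a b = 0 then pPar a b * Real.log (1 + 1 / pPar a b)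
  else 2 * qPar a b * (antiF a b c (tOne a b) - antiF a b c (tZero a b)
    + antiG a b c (tOne a b) - antiG a b c (tZero a b))

/-! ### The closed form of the integrals `I₁, …, I₅` -/

/-- The vectors `a` for `j = 1, …, 5`. -/
def parA (u v w : E3) : Fin 5 → E3 := ![w, v, v, u + v + w, u + v + w]

/-- The vectors `b` for `j = 1, …, 5`. -/
def parB (u v w : E3) : Fin 5 → E3 := ![v, w, u, -w, -w]

/-- The vectors `c` for `j = 1, …, 5`. -/
def parC (u v w : E3) : Fin 5 → E3 := ![u + v, u + v, w + v, u, v + w]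

/-- The first argument of the subtracted `H`: `a` for `I₁`, and `a - c` for `I₂, …, I₅`. -/
def parA' (u v w : E3) (j : Fin 5) : E3 :=
  if j = 0 then parA u v w j else parA u v w j - parC u v w j

/-- The second argument of the subtracted `H`: `b - c` for `I₁`, and `b` for `I₂, …, I₅`. -/
def parB' (u v w : E3) (j : Fin 5) : E3 :=
  if j = 0 then parB u v w j - parC u v w j else parB u v w j

/-- `|x| |c| + x · c`. -/
def logArg (x c : E3) : ℝ := ‖x‖ * ‖c‖ + inner ℝ x c

/-- Numerator and denominator of the quotient under the logarithm are positive. -/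
def LogDefined (u v w : E3) (j : Fin 5) : Prop :=
  0 < logArg (parA u v w j + parB u v w j) (parC u v w j) ∧
    0 < logArg (parA u v w j + parB u v w j - parC u v w j) (parC u v w j)

/-- The two integrals `H` that occur for `I_j` have integrands without a pole. -/
def RegularPair (u v w : E3) (j : Fin 5) : Prop :=
  Regular (parA u v w j) (parB u v w j) (parC u v w j) ∧
    Regular (parA' u v w j) (parB' u v w j) (parC u v w j)

/-- The right-hand side of the formula for `I_j`, with `H` as a parameter:
`ln(…) / |c| - (H(a, b - c, c) - H(a, b, c)) / |c|` for `j = 1` and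
`ln(…) / |c| - (H(a - c, b, c) - H(a, b, c)) / |c|` for `j = 2, …, 5`. -/
def edgeFormula (H : E3 → E3 → E3 → ℝ) (u v w : E3) (j : Fin 5) : ℝ :=
  1 / ‖parC u v w j‖ *
      Real.log (logArg (parA u v w j + parB u v w j) (parC u v w j) /
        logArg (parA u v w j + parB u v w j - parC u v w j) (parC u v w j)) -
    1 / ‖parC u v w j‖ *
      (H (parA' u v w j) (parB' u v w j) (parC u v w j) -
        H (parA u v w j) (parB u v w j) (parC u v w j))

end

end SingleLayerEdge

open SingleLayerEdge

namespace SingleLayerEdge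

open Set Filter Topology

/-! ### Norms, inner products and the argument of the logarithm -/

/-! Closed form of H. Along x = ηa + b the norm is |a|√((η+p)² + q²). The substitution η + p =
2qt/(1−t²) removes the root and turns h dη into a rational function of t with denominator
(1−t²)(α₀+α₁t+α₂t²) (`quadA_tPar`, `quadB_tPar`); `partial_fraction` splits it into the terms
integrated by F and G. D ≥ 0 is Bessel's inequality for ĉ.

Formula for I_j. In one variable each integrand is 1/|x| along a line of direction c, with
antiderivative ln(|x||c| + x·c)/|c| (`integral_div_norm`). The remaining integrals of ln `logArg`
(ηa+b) are done by parts: η(ln `logArg`)' = 1 − h (`mul_deriv_logArg`), which produces the boundary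
logarithm, −1 and H. If the segment meets the ray {−lc : l ≥ 0} at a parameter r, then h may have a
pole, but the logarithm stays integrable. The quadratic then has a double root t_r, and the singular
terms of the antiderivative combine to 2(η−r) ln|t−t_r|, which extends continuously. Hence the
closed form, unlike the integral H, remains valid there (`exists_continuous_logPrim`,
`integral_log_logArg`).

Regularisation. In the coordinates (y₁−x₁, y₂, x₂) the kernel is homogeneous of degree −1. Scaling
out the largest coordinate gives a factor 1/3, and after a translation a second scaling gives 1/2;
integrals over the unit square remain (`lintegral_cone`, `lintegral_refTriangle_pair`). All this is
done with lower integrals, so Tonelli needs no integrability; finiteness of the I_j then yields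
integrability of the kernel. The assumptions on the pair of triangles enter only through `EdgeCone`,
which keeps the denominators away from zero. -/

lemma inner_eq_pPar {a : E3} (ha : a ≠ 0) (b : E3) : inner ℝ a b = pPar a b * ‖a‖ ^ 2 := by
  have : ‖a‖ ≠ 0 := norm_ne_zero_iff.2 ha
  unfold pPar; field_simp

lemma qPar_sq {a : E3} (ha : a ≠ 0) (b : E3) :
    ‖b‖ ^ 2 = ‖a‖ ^ 2 * (pPar a b ^ 2 + qPar a b ^ 2) := by
  have hn : 0 < ‖a‖ := norm_pos_iff.2 ha
  have hcs := abs_real_inner_le_norm a b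
  rw [inner_eq_pPar ha, abs_mul, abs_of_pos (pow_pos hn 2)] at hcs
  have h1 : |pPar a b| * ‖a‖ ≤ ‖b‖ := by
    have : ‖a‖ * (|pPar a b| * ‖a‖) ≤ ‖a‖ * ‖b‖ := by nlinarith
    exact le_of_mul_le_mul_left this hn
  have h2 : 0 ≤ ‖b‖ ^ 2 / ‖a‖ ^ 2 - pPar a b ^ 2 := by
    rw [sub_nonneg, le_div_iff₀ (pow_pos hn 2), ← sq_abs (pPar a b), ← mul_pow]
    exact pow_le_pow_left₀ (by positivity) h1 2
  unfold qPar
  rw [Real.sq_sqrt h2]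
  field_simp
  ring

lemma norm_smul_add {a : E3} (ha : a ≠ 0) (b : E3) (η : ℝ) :
    ‖η • a + b‖ = ‖a‖ * √((η + pPar a b) ^ 2 + qPar a b ^ 2) := by
  rw [← sq_eq_sq₀ (norm_nonneg _) (by positivity), mul_pow, Real.sq_sqrt (by positivity),
    norm_add_sq_real, norm_smul, inner_smul_left, inner_eq_pPar ha, qPar_sq ha b, mul_pow]
  simp
  ring

lemma norm_hat {c : E3} (hc : c ≠ 0) : ‖hat c‖ = 1 := by
  have : ‖c‖ ≠ 0 := norm_ne_zero_iff.2 hc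
  simp [hat, norm_smul, this]

lemma inner_eq_norm_mul_inner_hat {c : E3} (hc : c ≠ 0) (x : E3) :
    inner ℝ x c = ‖c‖ * inner ℝ x (hat c) := by
  have : ‖c‖ ≠ 0 := norm_ne_zero_iff.2 hc
  simp [hat, inner_smul_right, this]

lemma logArg_eq {c : E3} (hc : c ≠ 0) (x : E3) :
    logArg x c = ‖c‖ * (‖x‖ + inner ℝ x (hat c)) := by
  rw [logArg, inner_eq_norm_mul_inner_hat hc]; ring

lemma logArg_nonneg (x c : E3) : 0 ≤ logArg x c := by
  have := neg_le_of_abs_le (abs_real_inner_le_norm x c)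
  unfold logArg; linarith

/-- Equality case of the Cauchy–Schwarz inequality for −x and c. -/
lemma logArg_eq_zero_iff {c : E3} (hc : c ≠ 0) (x : E3) :
    logArg x c = 0 ↔ ∃ l : ℝ, 0 ≤ l ∧ x = -(l • c) := by
  have hn : ‖c‖ ≠ 0 := norm_ne_zero_iff.2 hc
  constructor
  · intro h
    have h1 : inner ℝ (-x) c = ‖-x‖ * ‖c‖ := by
      rw [inner_neg_left, norm_neg]; unfold logArg at h; linarith
    rw [inner_eq_norm_mul_iff_real, norm_neg] at h1
    refine ⟨‖c‖⁻¹ * ‖x‖, by positivity, ?_⟩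
    rw [mul_smul, ← h1, smul_smul, inv_mul_cancel₀ hn]; simp
  · rintro ⟨l, hl, rfl⟩
    simp [logArg, norm_smul, inner_smul_left, abs_of_nonneg hl]
    ring

lemma logArg_pos_iff {c : E3} (hc : c ≠ 0) (x : E3) :
    0 < logArg x c ↔ ∀ l : ℝ, 0 ≤ l → x ≠ -(l • c) := by
  rw [(logArg_nonneg x c).lt_iff_ne', Ne, logArg_eq_zero_iff hc]
  push Not
  rfl

lemma continuous_logArg (c : E3) : Continuous fun x => logArg x c := by
  unfold logArg; fun_prop

/-! ### The coefficients of the closed form -/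

/-- The quadratic denominator `α₀ + α₁ t + α₂ t²`. -/
noncomputable def quadA (a b c : E3) (t : ℝ) : ℝ :=
  alpha0 a b c + alpha1 a b c * t + alpha2 a b c * t ^ 2

lemma alpha0_eq (a b c : E3) : alpha0 a b c =
    qPar a b * ‖a‖ + (inner ℝ b (hat c) - pPar a b * inner ℝ a (hat c)) := by
  simp [alpha0, inner_add_left, inner_smul_left]; ring

lemma alpha2_eq (a b c : E3) : alpha2 a b c =
    qPar a b * ‖a‖ - (inner ℝ b (hat c) - pPar a b * inner ℝ a (hat c)) := by
  simp [alpha2, inner_sub_left, inner_smul_left]; ring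

lemma qPar_nonneg (a b : E3) : 0 ≤ qPar a b := Real.sqrt_nonneg _

/-- Bessel's inequality for the unit vector ĉ and the orthogonal vectors a and b − pa, of norms |a|
and q|a|, cleared of denominators so that q = 0 is allowed. -/
lemma bessel {a : E3} (ha : a ≠ 0) (b : E3) {c : E3} (hc : c ≠ 0) :
    (inner ℝ b (hat c) - pPar a b * inner ℝ a (hat c)) ^ 2
      + qPar a b ^ 2 * inner ℝ a (hat c) ^ 2 ≤ qPar a b ^ 2 * ‖a‖ ^ 2 := by
  have hn : 0 < ‖a‖ := norm_pos_iff.2 ha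
  set w : E3 := b - pPar a b • a with hw
  have hwc : inner ℝ w (hat c) = inner ℝ b (hat c) - pPar a b * inner ℝ a (hat c) := by
    simp [hw, inner_sub_left, inner_smul_left]
  have hwa : inner ℝ a w = 0 := by
    rw [hw, inner_sub_right, inner_smul_right, inner_eq_pPar ha b, real_inner_self_eq_norm_sq]
    ring
  have hww : ‖w‖ ^ 2 = ‖a‖ ^ 2 * qPar a b ^ 2 := by
    rw [hw, norm_sub_sq_real, inner_smul_right, real_inner_comm, inner_eq_pPar ha b, qPar_sq ha b,
      norm_smul, mul_pow, Real.norm_eq_abs, sq_abs]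
    ring
  rw [← hwc]
  rcases (qPar_nonneg a b).eq_or_lt with hq | hq
  · have : w = 0 := by
      rw [← hq] at hww
      simpa using hww
    rw [← hq, this]; simp
  · have h1 := norm_hat hc
    set e := hat c
    set q := qPar a b
    -- The vector is |a|²q² times the component of ĉ orthogonal to a and w; its squared norm is
    -- |a|²q² times the difference of the two sides.
    have key := sq_nonneg ‖(‖a‖ ^ 2 * q ^ 2) • e - (q ^ 2 * inner ℝ a e) • a - inner ℝ w e • w‖
    rw [← real_inner_self_eq_norm_sq] at key
    simp only [inner_sub_left, inner_sub_right, inner_smul_left, inner_smul_right,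
      real_inner_self_eq_norm_sq, hwa, hww, h1, real_inner_comm a e, real_inner_comm w e,
      real_inner_comm a w, RCLike.conj_to_real] at key
    have h2 : 0 ≤ (‖a‖ ^ 2 * q ^ 2) *
        (q ^ 2 * ‖a‖ ^ 2 - inner ℝ w e ^ 2 - q ^ 2 * inner ℝ a e ^ 2) := by
      simp only [real_inner_comm e a, real_inner_comm e w] at key ⊢
      nlinarith [key]
    have := nonneg_of_mul_nonneg_right h2 (by positivity)
    linarith

lemma disc_eq (a b c : E3) : disc a b c = 4 * (qPar a b ^ 2 * ‖a‖ ^ 2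
    - (inner ℝ b (hat c) - pPar a b * inner ℝ a (hat c)) ^ 2
    - qPar a b ^ 2 * inner ℝ a (hat c) ^ 2) := by
  rw [disc, alpha0_eq, alpha2_eq, alpha1]; ring

lemma disc_nonneg {a : E3} (ha : a ≠ 0) (b : E3) {c : E3} (hc : c ≠ 0) : 0 ≤ disc a b c := by
  rw [disc_eq]
  have := bessel ha b hc
  linarith

lemma eq_neg_norm_smul_hat {a : E3} {c : E3} (hc : c ≠ 0) (h : ‖a‖ + inner ℝ a (hat c) = 0) :
    a = -(‖a‖ • hat c) := by
  have hn : ‖c‖ ≠ 0 := norm_ne_zero_iff.2 hc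
  obtain ⟨l, hl, h1⟩ := (logArg_eq_zero_iff hc a).1 (by rw [logArg_eq hc, h, mul_zero])
  have : ‖a‖ = l * ‖c‖ := by rw [h1, norm_neg, norm_smul, Real.norm_of_nonneg hl]
  rw [this, hat, smul_smul, mul_assoc, mul_inv_cancel₀ hn, mul_one, ← h1]

/-- The partial fraction decomposition. -/
lemma partial_fraction {a : E3} (ha : a ≠ 0) {b : E3} (hq : 0 < qPar a b) {c : E3} (hc : c ≠ 0)
    (t : ℝ) :
    beta0 a b c + beta1 a b * t + beta2 a b c * t ^ 2 =
      gamma1 a b c * (1 + t) * quadA a b c t + gamma2 a b c * (1 - t) * quadA a b c t +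
        (gamma3 a b c + gamma4 a b c * t) * (1 - t ^ 2) := by
  have hn : 0 < ‖a‖ := norm_pos_iff.2 ha
  -- Both sides have degree at most three in t. The values at t = 1 and t = −1 determine γ₁ and γ₂;
  -- γ₃ and γ₄ match the value at 0 and the coefficient of t³.
  have h1 : beta0 a b c + beta1 a b + beta2 a b c = 2 * gamma1 a b c * quadA a b c 1 := by
    have e : quadA a b c 1 = alpha0 a b c + alpha1 a b c + alpha2 a b c := by simp [quadA]
    rw [e]
    by_cases h : alpha0 a b c + alpha1 a b c + alpha2 a b c = 0
    · rw [h, mul_zero]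
      rw [alpha0_eq, alpha1, alpha2_eq] at h
      -- The vanishing denominator means a = −|a|ĉ, and then the numerator vanishes too.
      have h' : ‖a‖ + inner ℝ a (hat c) = 0 := by
        have : (2 * qPar a b) * (‖a‖ + inner ℝ a (hat c)) = 0 := by linarith
        exact (mul_eq_zero.1 this).resolve_left (by positivity)
      have h2 := eq_neg_norm_smul_hat hc h'
      have h3 := inner_eq_pPar ha b
      rw [h2, inner_neg_left, inner_smul_left, ← h2, real_inner_comm] at h3
      simp at h3
      have : inner ℝ b (hat c) = - (pPar a b * ‖a‖) := by
        apply mul_left_cancel₀ hn.ne'; linarith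
      rw [beta0, beta1, beta2]; linarith
    · rw [gamma1]; field_simp
  have h2 : beta0 a b c - beta1 a b + beta2 a b c = 2 * gamma2 a b c * quadA a b c (-1) := by
    have e : quadA a b c (-1) = alpha0 a b c - alpha1 a b c + alpha2 a b c := by
      simp [quadA]; ring
    rw [e]
    by_cases h : alpha0 a b c - alpha1 a b c + alpha2 a b c = 0
    · rw [h, mul_zero]
      rw [alpha0_eq, alpha1, alpha2_eq] at h
      have h' : ‖-a‖ + inner ℝ (-a) (hat c) = 0 := by
        rw [norm_neg, inner_neg_left]
        have : (2 * qPar a b) * (‖a‖ + - inner ℝ a (hat c)) = 0 := by linarith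
        exact (mul_eq_zero.1 this).resolve_left (by positivity)
      have h2 := eq_neg_norm_smul_hat hc h'
      rw [norm_neg, neg_inj] at h2
      have h3 := inner_eq_pPar ha b
      rw [h2, inner_smul_left, ← h2, real_inner_comm] at h3
      simp at h3
      have : inner ℝ b (hat c) = pPar a b * ‖a‖ := by
        apply mul_left_cancel₀ hn.ne'; linarith
      rw [beta0, beta1, beta2]; linarith
    · rw [gamma2]; field_simp
  have h3 : gamma3 a b c = beta0 a b c - (gamma1 a b c + gamma2 a b c) * alpha0 a b c := rfl
  have h4 : gamma4 a b c = alpha2 a b c * (gamma1 a b c - gamma2 a b c) := rfl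
  simp only [quadA] at h1 h2 ⊢
  rw [h3, h4]
  linear_combination (t + t ^ 2) / 2 * h1 + (t ^ 2 - t) / 2 * h2

lemma alpha1_eq_zero {a : E3} (ha : a ≠ 0) (b : E3) {c : E3} (hc : c ≠ 0)
    (h : alpha2 a b c = 0) : alpha1 a b c = 0 := by
  have := disc_nonneg ha b hc
  rw [disc, h] at this
  nlinarith

lemma alpha0_eq_of_alpha2 {a b c : E3} (h : alpha2 a b c = 0) :
    alpha0 a b c = 2 * qPar a b * ‖a‖ := by
  rw [alpha2_eq] at h; rw [alpha0_eq]; linarith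

/-- For α₂ = 0 the sign of D forces α₁ = 0, so that a ⊥ ĉ and b·ĉ = q|a|, and the γ's become
explicit. This justifies the value G = 0 in that case. -/
lemma gamma_eq_zero {a : E3} (ha : a ≠ 0) {b : E3} (hq : 0 < qPar a b) {c : E3} (hc : c ≠ 0)
    (h : alpha2 a b c = 0) : gamma3 a b c = 0 ∧ gamma4 a b c = 0 := by
  have hn : 0 < ‖a‖ := norm_pos_iff.2 ha
  have h1 := alpha1_eq_zero ha b hc h
  have h0 := alpha0_eq_of_alpha2 h
  have hκ : inner ℝ a (hat c) = 0 := by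
    rw [alpha1] at h1; simpa [hq.ne'] using h1
  refine ⟨?_, by simp [gamma4, h]⟩
  have hb : inner ℝ b (hat c) = qPar a b * ‖a‖ := by
    rw [alpha2_eq, hκ] at h; linarith
  rw [gamma3, gamma1, gamma2, h1, h, h0, beta0, beta1, beta2, hb]
  field_simp
  ring

/-! ### The antiderivative -/

lemma hasDerivAt_antiF (a b c : E3) {t : ℝ} (h1 : -1 < t) (h2 : t < 1) :
    HasDerivAt (antiF a b c) (gamma1 a b c / (1 - t) + gamma2 a b c / (1 + t)) t := by
  have e1 : HasDerivAt (fun t : ℝ => Real.log |1 + t|) (1 / (1 + t)) t := by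
    simp_rw [Real.log_abs]
    exact ((hasDerivAt_id t).const_add 1).log (by simp; linarith)
  have e2 : HasDerivAt (fun t : ℝ => Real.log |1 - t|) (-1 / (1 - t)) t := by
    simp_rw [Real.log_abs]
    exact ((hasDerivAt_id t).const_sub 1).log (by simp; linarith)
  refine ((e1.const_mul (gamma2 a b c)).sub (e2.const_mul (gamma1 a b c))).congr_deriv ?_
  ring

lemma hasDerivAt_antiG {a : E3} (ha : a ≠ 0) {b : E3} (hq : 0 < qPar a b) {c : E3} (hc : c ≠ 0)
    {t : ℝ} (ht : quadA a b c t ≠ 0 ∨ (gamma3 a b c = 0 ∧ gamma4 a b c = 0)) :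
    HasDerivAt (antiG a b c) ((gamma3 a b c + gamma4 a b c * t) / quadA a b c t) t := by
  have hD := disc_nonneg ha b hc
  by_cases h : alpha2 a b c = 0 ∨ (gamma3 a b c = 0 ∧ gamma4 a b c = 0)
  · have h' : gamma3 a b c = 0 ∧ gamma4 a b c = 0 := h.elim (gamma_eq_zero ha hq hc) id
    have : antiG a b c = fun _ => 0 := by ext t; rw [antiG, if_pos h]
    rw [this, h'.1, h'.2]
    simpa using hasDerivAt_const t (0 : ℝ)
  have ht' : quadA a b c t ≠ 0 := ht.resolve_right fun h' => h (Or.inr h')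
  have hα : alpha2 a b c ≠ 0 := fun h' => h (Or.inl h')
  have hA : HasDerivAt (quadA a b c) (alpha1 a b c + alpha2 a b c * (2 * t)) t := by
    have := (((hasDerivAt_id t).const_mul (alpha1 a b c)).const_add (alpha0 a b c)).add
      ((hasDerivAt_pow 2 t).const_mul (alpha2 a b c))
    refine this.congr_deriv ?_
    simp
  rcases hD.eq_or_lt with hd | hd
  · have e : antiG a b c = fun t => gamma4 a b c / alpha2 a b c *
        Real.log (t + alpha1 a b c / (2 * alpha2 a b c)) -
        (2 * gamma3 a b c * alpha2 a b c - gamma4 a b c * alpha1 a b c) *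
        (alpha2 a b c * (2 * alpha2 a b c * t + alpha1 a b c))⁻¹ := by
      ext t
      rw [antiG, if_neg h, if_neg (by rw [← hd]; simp), Real.log_abs,
        div_eq_mul_inv (2 * _ * _ - _)]
    -- For D = 0 the quadratic is a perfect square up to the factor 4α₂.
    have hsq : 4 * alpha2 a b c * quadA a b c t = (2 * alpha2 a b c * t + alpha1 a b c) ^ 2 := by
      rw [disc] at hd; rw [quadA]; linear_combination -hd
    have hz : 2 * alpha2 a b c * t + alpha1 a b c ≠ 0 := by
      intro h0
      rw [h0] at hsq
      simp [hα, ht'] at hsq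
    have hz' : t + alpha1 a b c / (2 * alpha2 a b c) ≠ 0 := by
      intro h0
      apply hz; field_simp at h0; linarith
    have d1 := (((hasDerivAt_id t).add_const (alpha1 a b c / (2 * alpha2 a b c))).log hz').const_mul
      (gamma4 a b c / alpha2 a b c)
    have d2 := (((((hasDerivAt_id t).const_mul (2 * alpha2 a b c)).add_const
      (alpha1 a b c)).const_mul (alpha2 a b c)).fun_inv (mul_ne_zero hα hz)).const_mul
      (2 * gamma3 a b c * alpha2 a b c - gamma4 a b c * alpha1 a b c)
    rw [e]
    refine (d1.sub d2).congr_deriv ?_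
    have hA' : quadA a b c t = (2 * alpha2 a b c * t + alpha1 a b c) ^ 2 / (4 * alpha2 a b c) := by
      rw [← hsq]; field_simp
    rw [hA']
    have : t + alpha1 a b c / (2 * alpha2 a b c) =
      (2 * alpha2 a b c * t + alpha1 a b c) / (2 * alpha2 a b c) := by field_simp
    simp only [id]
    rw [this]
    field_simp
    ring
  · have e : antiG a b c = fun t => gamma4 a b c / (2 * alpha2 a b c) *
        Real.log (quadA a b c t) +
      (2 * gamma3 a b c * alpha2 a b c - gamma4 a b c * alpha1 a b c) /
          (alpha2 a b c * √(disc a b c)) *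
        Real.arctan ((alpha1 a b c + 2 * alpha2 a b c * t) / √(disc a b c)) := by
      ext t; rw [antiG, if_neg h, if_pos hd, Real.log_abs, quadA]
    have hs : 0 < √(disc a b c) := Real.sqrt_pos.2 hd
    have hs2 : √(disc a b c) ^ 2 = disc a b c := Real.sq_sqrt hd.le
    have d1 := (hA.log ht').const_mul (gamma4 a b c / (2 * alpha2 a b c))
    have d2 := (((((hasDerivAt_id t).const_mul (2 * alpha2 a b c)).const_add
      (alpha1 a b c)).div_const √(disc a b c)).arctan).const_mul
      ((2 * gamma3 a b c * alpha2 a b c - gamma4 a b c * alpha1 a b c) /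
          (alpha2 a b c * √(disc a b c)))
    rw [e]
    refine (d1.add d2).congr_deriv ?_
    simp only [id]
    -- Completing the square: 4α₂(α₀+α₁t+α₂t²) = D + (α₁+2α₂t)².
    have h4 : 1 + ((alpha1 a b c + 2 * alpha2 a b c * t) / √(disc a b c)) ^ 2 =
        4 * alpha2 a b c * quadA a b c t / disc a b c := by
      rw [div_pow, hs2, quadA, eq_div_iff hd.ne', add_mul, div_mul_cancel₀ _ hd.ne', disc]
      ring
    rw [h4]
    rw [div_div_eq_mul_div]
    generalize √(disc a b c) = r at hs hs2 ⊢
    rw [← hs2]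
    field_simp
    ring

/-! ### The substitution `s = 2 q t / (1 - t²)` -/

/-- The inverse `t(s)` of the substitution `s = 2 q t / (1 - t²)`. -/
noncomputable def tSub (q s : ℝ) : ℝ := s / (q + √(s ^ 2 + q ^ 2))

section
variable {q : ℝ} (hq : 0 < q) (s : ℝ)
include hq

lemma root_pos : 0 < √(s ^ 2 + q ^ 2) := Real.sqrt_pos.2 (by positivity)

omit hq in
lemma root_sq : √(s ^ 2 + q ^ 2) ^ 2 = s ^ 2 + q ^ 2 := Real.sq_sqrt (by positivity)

lemma one_sub_tSub_sq : 1 - tSub q s ^ 2 = 2 * q / (q + √(s ^ 2 + q ^ 2)) := by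
  have h1 := root_pos hq s
  have h2 := root_sq (q := q) s
  unfold tSub
  field_simp
  linear_combination h2

lemma tSub_lt_one : tSub q s < 1 := by
  have h : 0 < 1 - tSub q s ^ 2 := by
    have h1 := root_pos hq s
    rw [one_sub_tSub_sq hq]; positivity
  nlinarith

lemma neg_one_lt_tSub : -1 < tSub q s := by
  have h : 0 < 1 - tSub q s ^ 2 := by
    have h1 := root_pos hq s
    rw [one_sub_tSub_sq hq]; positivity
  nlinarith

lemma one_sub_tSub_sq_pos : 0 < 1 - tSub q s ^ 2 := by
  nlinarith [tSub_lt_one hq s, neg_one_lt_tSub hq s]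

lemma eq_of_tSub : s = 2 * q * tSub q s / (1 - tSub q s ^ 2) := by
  have h1 := root_pos hq s
  rw [one_sub_tSub_sq hq]
  unfold tSub
  field_simp

lemma hasDerivAt_tSub :
    HasDerivAt (tSub q) (q / (√(s ^ 2 + q ^ 2) * (q + √(s ^ 2 + q ^ 2)))) s := by
  have h1 := root_pos hq s
  have h2 := root_sq (q := q) s
  have d : HasDerivAt (fun s : ℝ => √(s ^ 2 + q ^ 2)) (s / √(s ^ 2 + q ^ 2)) s := by
    refine (((hasDerivAt_pow 2 s).add_const (q ^ 2)).sqrt (by positivity)).congr_deriv ?_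
    field_simp
    simp
  refine ((hasDerivAt_id s).div (d.const_add q) (by positivity)).congr_deriv ?_
  simp only [id]
  field_simp
  linear_combination h2

lemma continuous_tSub : Continuous (tSub q) :=
  continuous_iff_continuousAt.2 fun s => (hasDerivAt_tSub hq s).continuousAt

end

/-- The variable `t` as a function of `η`. -/
noncomputable def tPar (a b : E3) (η : ℝ) : ℝ := tSub (qPar a b) (η + pPar a b)

lemma tZero_eq (a b : E3) : tZero a b = tPar a b 0 := by simp [tZero, tPar, tSub]

lemma tOne_eq (a b : E3) : tOne a b = tPar a b 1 := by simp [tOne, tPar, tSub, add_comm]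

section
variable {a b : E3} (hq : 0 < qPar a b) (η : ℝ)
include hq

lemma tPar_lt_one : tPar a b η < 1 := tSub_lt_one hq _

lemma neg_one_lt_tPar : -1 < tPar a b η := neg_one_lt_tSub hq _

lemma one_sub_tPar_sq_pos : 0 < 1 - tPar a b η ^ 2 := one_sub_tSub_sq_pos hq _

lemma hasDerivAt_tPar : HasDerivAt (tPar a b)
    (qPar a b / (√((η + pPar a b) ^ 2 + qPar a b ^ 2) *
      (qPar a b + √((η + pPar a b) ^ 2 + qPar a b ^ 2)))) η :=
  HasDerivAt.comp_add_const η (pPar a b) (hasDerivAt_tSub hq (η + pPar a b))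

lemma continuous_tPar : Continuous (tPar a b) :=
  (continuous_tSub hq).comp (continuous_id.add continuous_const)

end

/-! ### The integrand `h` in the variable `t` -/

section
variable {a : E3} (ha : a ≠ 0) {b : E3} (hq : 0 < qPar a b) {c : E3}
include ha hq

/-- With R = √((η+p)²+q²) one has |ηa+b| = |a|R and 1 − t² = 2q/(q+R); what is left is R² = (η+p)² +
q². The α's are defined to make this hold. -/
lemma quadA_tPar (c : E3) (η : ℝ) : quadA a b c (tPar a b η) =
    (1 - tPar a b η ^ 2) * (‖η • a + b‖ + inner ℝ (η • a + b) (hat c)) := by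
  have h1 := root_pos hq (η + pPar a b)
  have h2 := root_sq (q := qPar a b) (η + pPar a b)
  rw [norm_smul_add ha, inner_add_left, inner_smul_left]
  unfold tPar
  rw [one_sub_tSub_sq hq, quadA, alpha0_eq, alpha1, alpha2_eq, tSub]
  generalize √((η + pPar a b) ^ 2 + qPar a b ^ 2) = R at *
  simp only [RCLike.conj_to_real]
  field_simp
  linear_combination (-qPar a b * ‖a‖ + (inner ℝ b (hat c) - pPar a b * inner ℝ a (hat c))) * h2

lemma quadA_tPar_eq_zero_iff (hc : c ≠ 0) (η : ℝ) :
    quadA a b c (tPar a b η) = 0 ↔ logArg (η • a + b) c = 0 := by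
  have : 1 - tPar a b η ^ 2 ≠ 0 := (one_sub_tPar_sq_pos hq _).ne'
  rw [quadA_tPar ha hq, logArg_eq hc]
  simp [this, hc]

lemma norm_smul_add_pos (η : ℝ) : 0 < ‖η • a + b‖ := by
  have h1 := root_pos hq (η + pPar a b)
  have : 0 < ‖a‖ := norm_pos_iff.2 ha
  rw [norm_smul_add ha]; positivity

/-- Counterpart for the numerator of h. The prefactor equals (1−t²)/(q|a|); together with dt/dη =
q/(R(q+R)) it supplies the factor 1/|ηa+b| = 1/(|a|R) of h. -/
lemma quadB_tPar (c : E3) (η : ℝ) :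
    beta0 a b c + beta1 a b * tPar a b η + beta2 a b c * tPar a b η ^ 2 =
      2 / (‖a‖ * (qPar a b + √((η + pPar a b) ^ 2 + qPar a b ^ 2))) *
        (inner ℝ (η • a + b) b + ‖η • a + b‖ * inner ℝ b (hat c)) := by
  have h1 := root_pos hq (η + pPar a b)
  have h2 := root_sq (q := qPar a b) (η + pPar a b)
  have : 0 < ‖a‖ := norm_pos_iff.2 ha
  rw [norm_smul_add ha, inner_add_left, inner_smul_left, inner_eq_pPar ha,
    real_inner_self_eq_norm_sq, qPar_sq ha b]
  unfold tPar
  rw [beta0, beta1, beta2, tSub]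
  generalize √((η + pPar a b) ^ 2 + qPar a b ^ 2) = R at *
  simp only [RCLike.conj_to_real]
  field_simp
  linear_combination (qPar a b * ‖a‖ - inner ℝ b (hat c)) * h2

/-- The antiderivative of `h`. -/
lemma hasDerivAt_antiF_add_antiG (hc : c ≠ 0) {η : ℝ} (hL : logArg (η • a + b) c ≠ 0) :
    HasDerivAt (fun η => 2 * qPar a b * (antiF a b c (tPar a b η) + antiG a b c (tPar a b η)))
      (hFun a b c η) η := by
  have hA := (quadA_tPar_eq_zero_iff ha hq hc η).not.2 hL
  have dt := hasDerivAt_tPar hq η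
  have d := (((hasDerivAt_antiF a b c (neg_one_lt_tPar hq _) (tPar_lt_one hq _)).comp η dt).add
    ((hasDerivAt_antiG ha hq hc (Or.inl hA)).comp η dt)).const_mul (2 * qPar a b)
  refine d.congr_deriv ?_
  have hpf := partial_fraction ha hq hc (tPar a b η)
  have h1 : 1 - tPar a b η ≠ 0 := by have := tPar_lt_one hq η; linarith
  have h2 : 1 + tPar a b η ≠ 0 := by have := neg_one_lt_tPar hq η; linarith
  have h12 : 1 - tPar a b η ^ 2 ≠ 0 := by
    rw [show 1 - tPar a b η ^ 2 = (1 - tPar a b η) * (1 + tPar a b η) by ring]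
    exact mul_ne_zero h1 h2
  have hsum : gamma1 a b c / (1 - tPar a b η) + gamma2 a b c / (1 + tPar a b η) +
      (gamma3 a b c + gamma4 a b c * tPar a b η) / quadA a b c (tPar a b η) =
      (beta0 a b c + beta1 a b * tPar a b η + beta2 a b c * tPar a b η ^ 2) /
        ((1 - tPar a b η ^ 2) * quadA a b c (tPar a b η)) := by
    rw [hpf, show 1 - tPar a b η ^ 2 = (1 - tPar a b η) * (1 + tPar a b η) by ring]
    field_simp
  have hR := root_pos hq (η + pPar a b)
  have hx := norm_smul_add_pos ha hq η
  have hn : 0 < ‖a‖ := norm_pos_iff.2 ha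
  have hden : ‖η • a + b‖ + inner ℝ (η • a + b) (hat c) ≠ 0 := by
    rw [logArg_eq hc] at hL; exact right_ne_zero_of_mul hL
  rw [← add_mul, hsum,
    quadB_tPar ha hq, quadA_tPar ha hq]
  rw [hFun]
  have h3 : 1 - tPar a b η ^ 2 =
    2 * qPar a b / (qPar a b + √((η + pPar a b) ^ 2 + qPar a b ^ 2)) := one_sub_tSub_sq hq _
  have h4 : ‖η • a + b‖ ^ 2 + ‖η • a + b‖ * inner ℝ (η • a + b) (hat c) =
    ‖η • a + b‖ * (‖η • a + b‖ + inner ℝ (η • a + b) (hat c)) := by ring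
  rw [h3, h4]
  rw [norm_smul_add ha] at hden ⊢
  generalize √((η + pPar a b) ^ 2 + qPar a b ^ 2) = R at *
  generalize inner ℝ (η • a + b) b = y1 at *
  generalize inner ℝ (η • a + b) (hat c) = y2 at *
  generalize inner ℝ b (hat c) = y3 at *
  field_simp

/-- A root of the quadratic denominator that is attained for a parameter `η`. -/
lemma root_facts (hc : c ≠ 0) {η : ℝ} (hL : logArg (η • a + b) c = 0) :
    disc a b c = 0 ∧ alpha2 a b c ≠ 0 ∧ 2 * alpha2 a b c * tPar a b η + alpha1 a b c = 0 ∧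
      gamma3 a b c + gamma4 a b c * tPar a b η = 0 ∧
      qPar a b * (gamma1 a b c - gamma2 a b c) = -η := by
  have hA := (quadA_tPar_eq_zero_iff ha hq hc η).2 hL
  have hn : 0 < ‖a‖ := norm_pos_iff.2 ha
  have hα : alpha2 a b c ≠ 0 := by
    intro h
    rw [quadA, h, alpha1_eq_zero ha b hc h, alpha0_eq_of_alpha2 h] at hA
    have : 0 < 2 * qPar a b * ‖a‖ := by positivity
    linarith
  have hD := disc_nonneg ha b hc
  -- At the root a square plus D ≥ 0 is zero, so both vanish: the root is double.
  have hsq : (2 * alpha2 a b c * tPar a b η + alpha1 a b c) ^ 2 + disc a b c = 0 := by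
    rw [quadA] at hA; rw [disc]; linear_combination 4 * alpha2 a b c * hA
  have hs := sq_nonneg (2 * alpha2 a b c * tPar a b η + alpha1 a b c)
  have hr := norm_smul_add ha b η
  have hR := root_pos hq (η + pPar a b)
  have hR2 := root_sq (q := qPar a b) (η + pPar a b)
  set R := √((η + pPar a b) ^ 2 + qPar a b ^ 2) with hRdef
  have hx : η • a + b = -((‖a‖ * R) • hat c) := by
    rw [← hr]
    refine eq_neg_norm_smul_hat hc ?_
    rw [logArg_eq hc] at hL
    exact (mul_eq_zero.1 hL).resolve_left (norm_ne_zero_iff.2 hc)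
  have e1 : η * inner ℝ a (hat c) + inner ℝ b (hat c) = -(‖a‖ * R) := by
    have := congrArg (fun x => inner ℝ x (hat c)) hx
    simpa [inner_add_left, inner_smul_left, norm_hat hc] using this
  have e2 : (η + pPar a b) * ‖a‖ = -(R * inner ℝ a (hat c)) := by
    have := congrArg (fun x => inner ℝ a x) hx
    simp only [inner_add_right, inner_smul_right, inner_neg_right, real_inner_self_eq_norm_sq,
      inner_eq_pPar ha b] at this
    apply mul_left_cancel₀ hn.ne'
    linear_combination this
  have e3 : inner ℝ (η • a + b) b + ‖η • a + b‖ * inner ℝ b (hat c) = 0 := by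
    rw [hr]
    nth_rw 1 [hx]
    rw [inner_neg_left, inner_smul_left, real_inner_comm b (hat c)]
    simp
  -- Since q > 0, a is not parallel to ĉ, and the denominators of γ₁ and γ₂ do not vanish.
  have hκ : inner ℝ a (hat c) ^ 2 < ‖a‖ ^ 2 := by
    have : 0 < R ^ 2 * (‖a‖ ^ 2 - inner ℝ a (hat c) ^ 2) := by
      have : R ^ 2 * (‖a‖ ^ 2 - inner ℝ a (hat c) ^ 2) = qPar a b ^ 2 * ‖a‖ ^ 2 := by
        linear_combination ((η + pPar a b) * ‖a‖ - R * inner ℝ a (hat c)) * e2 + ‖a‖ ^ 2 * hR2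
      rw [this]; positivity
    have := pos_of_mul_pos_right this (by positivity)
    linarith
  have hκ' := abs_lt_of_sq_lt_sq hκ hn.le
  rw [abs_lt] at hκ'
  refine ⟨by linarith, hα, by nlinarith, ?_, ?_⟩
  · have hpf := partial_fraction ha hq hc (tPar a b η)
    rw [quadB_tPar ha hq, e3, hA] at hpf
    have : 0 < 1 - tPar a b η ^ 2 := one_sub_tPar_sq_pos hq _
    have h0 : (gamma3 a b c + gamma4 a b c * tPar a b η) * (1 - tPar a b η ^ 2) = 0 := by
      linarith
    exact (mul_eq_zero.1 h0).resolve_right this.ne'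
  · have k1 : ‖a‖ + inner ℝ a (hat c) ≠ 0 := by linarith [hκ'.1]
    have k2 : ‖a‖ - inner ℝ a (hat c) ≠ 0 := by linarith [hκ'.2]
    have g1 : gamma1 a b c = (inner ℝ b (hat c) + pPar a b * ‖a‖) /
        (2 * qPar a b * (‖a‖ + inner ℝ a (hat c))) := by
      have : alpha0 a b c + alpha1 a b c + alpha2 a b c =
        2 * qPar a b * (‖a‖ + inner ℝ a (hat c)) := by
        rw [alpha0_eq, alpha1, alpha2_eq]; ring
      rw [gamma1, this, beta0, beta1, beta2]
      field_simp
      ring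
    have g2 : gamma2 a b c = (inner ℝ b (hat c) - pPar a b * ‖a‖) /
        (2 * qPar a b * (‖a‖ - inner ℝ a (hat c))) := by
      have : alpha0 a b c - alpha1 a b c + alpha2 a b c =
        2 * qPar a b * (‖a‖ - inner ℝ a (hat c)) := by
        rw [alpha0_eq, alpha1, alpha2_eq]; ring
      rw [gamma2, this, beta0, beta1, beta2]
      field_simp
      ring
    rw [g1, g2]
    field_simp
    linear_combination 2 * ‖a‖ * e2 - 2 * inner ℝ a (hat c) * e1

end

/-! ### The closed form of `H` -/

lemma regular_iff {a b c : E3} (hc : c ≠ 0) :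
    Regular a b c ↔ ∀ η ∈ Ioc (0 : ℝ) 1, 0 < logArg (η • a + b) c := by
  refine forall₂_congr fun η _ => ?_
  rw [(logArg_nonneg _ c).lt_iff_ne', logArg_eq hc]
  simp [hc]

lemma hFun_eq_div (a b c : E3) (η : ℝ) : hFun a b c η =
    (inner ℝ (η • a + b) b + ‖η • a + b‖ * inner ℝ b (hat c)) /
    (‖η • a + b‖ * (‖η • a + b‖ + inner ℝ (η • a + b) (hat c))) := by
  rw [hFun]; ring_nf

lemma intervalIntegrable_and_integral_of_eqOn {f g : ℝ → ℝ} {y : ℝ}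
    (h : ∀ η ∈ Ioc (0 : ℝ) 1, g η = f η)
    (hf : IntervalIntegrable f volume 0 1 ∧ ∫ η in (0 : ℝ)..1, f η = y) :
    IntervalIntegrable g volume 0 1 ∧ ∫ η in (0 : ℝ)..1, g η = y := by
  rw [← uIoc_of_le zero_le_one] at h
  refine ⟨hf.1.congr fun η hη => (h η hη).symm, ?_⟩
  rw [← hf.2]
  exact intervalIntegral.integral_congr_ae (ae_of_all _ h)

lemma smul_add_eq_of_qPar {a b : E3} (ha : a ≠ 0) (hq : qPar a b = 0) : b = pPar a b • a := by
  have h := norm_smul_add ha b (-pPar a b)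
  rw [hq] at h
  simp at h
  rw [neg_add_eq_zero] at h
  exact h.symm

/-- Here b is the multiple p/(η+p) of x = ηa + b, and the factor |x|² + |x| x·ĉ cancels. -/
lemma hFun_of_qPar_eq_zero {a b c : E3} (ha : a ≠ 0) (hc : c ≠ 0) (hq : qPar a b = 0) {η : ℝ}
    (hL : logArg (η • a + b) c ≠ 0) : hFun a b c η = pPar a b / (η + pPar a b) := by
  have hb := smul_add_eq_of_qPar ha hq
  rw [logArg_eq hc] at hL
  have hden := right_ne_zero_of_mul hL
  rw [hFun_eq_div]
  generalize pPar a b = p at hb ⊢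
  have hx : η • a + b = (η + p) • a := by rw [hb, add_smul]
  rw [hx] at hden ⊢
  have hx0 : (η + p) • a ≠ 0 := by
    intro h; simp [h] at hden
  have hs : η + p ≠ 0 := fun h => hx0 (by simp [h])
  have hb' : b = (p / (η + p)) • ((η + p) • a) := by rw [smul_smul, div_mul_cancel₀ _ hs, hb]
  rw [hb']
  have hn := norm_ne_zero_iff.2 hx0
  generalize (η + p) • a = x at *
  rw [inner_smul_right, inner_smul_left, real_inner_self_eq_norm_sq]
  simp only [RCLike.conj_to_real]
  field_simp

lemma hIntegral_of_regular {a b c : E3} (hc : c ≠ 0) (h : Regular a b c) :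
    IntervalIntegrable (hFun a b c) volume 0 1 ∧ hIntegral a b c = hClosed a b c := by
  have hreg := (regular_iff hc).1 h
  unfold hIntegral
  rw [hClosed]
  by_cases ha : a = 0
  · rw [if_pos ha]
    refine intervalIntegrable_and_integral_of_eqOn (f := fun _ => 1) (fun η hη => ?_) (by simp)
    have h1 := h η hη
    have h2 := hreg η hη
    rw [ha, smul_zero, zero_add] at h1 h2
    have : b ≠ 0 := by rintro rfl; simp [logArg] at h2
    rw [hFun_eq_div, ha, smul_zero, zero_add, real_inner_self_eq_norm_sq, ← div_self
      (mul_ne_zero (norm_ne_zero_iff.2 this) h1)]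
    ring
  rw [if_neg ha]
  by_cases hq : qPar a b = 0
  · rw [if_pos hq]
    have hs : ∀ η ∈ Ioc (0 : ℝ) 1, η + pPar a b ≠ 0 := by
      intro η hη h0
      have := hreg η hη
      rw [smul_add_eq_of_qPar ha hq, ← add_smul, h0] at this
      simp [logArg] at this
    refine intervalIntegrable_and_integral_of_eqOn
      (fun η hη => hFun_of_qPar_eq_zero ha hc hq (hreg η hη).ne') ?_
    generalize pPar a b = p at hs
    by_cases hp : p = 0
    · simp [hp]
    have hs' : ∀ η ∈ uIcc (0 : ℝ) 1, η + p ≠ 0 := by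
      intro η hη
      rw [uIcc_of_le zero_le_one] at hη
      rcases hη.1.eq_or_lt with h0 | h0
      · rwa [← h0, zero_add]
      · exact hs η ⟨h0, hη.2⟩
    have hc' : ContinuousOn (fun η : ℝ => p / (η + p)) (uIcc 0 1) :=
      continuousOn_const.div (by fun_prop) hs'
    refine ⟨hc'.intervalIntegrable, ?_⟩
    -- `Real.log` is ln|·|, so negative values of η + p are covered.
    have hd : ∀ η ∈ uIcc (0 : ℝ) 1,
        HasDerivAt (fun η => p * Real.log (η + p)) (p / (η + p)) η := by
      intro η hη
      refine ((((hasDerivAt_id η).add_const p).log (hs' η hη)).const_mul p).congr_deriv ?_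
      simp; ring
    rw [intervalIntegral.integral_eq_sub_of_hasDerivAt hd hc'.intervalIntegrable]
    have h1 : 1 + p ≠ 0 := hs' 1 (by simp)
    rw [show 1 + 1 / p = (1 + p) / p by field_simp; ring, Real.log_div h1 hp, zero_add]
    ring
  rw [if_neg hq]
  have hq' : 0 < qPar a b := (qPar_nonneg a b).lt_of_ne' hq
  set Φ := fun η => 2 * qPar a b * (antiF a b c (tPar a b η) + antiG a b c (tPar a b η)) with hΦ
  have hval : 2 * qPar a b * (antiF a b c (tOne a b) - antiF a b c (tZero a b)
    + antiG a b c (tOne a b) - antiG a b c (tZero a b)) = Φ 1 - Φ 0 := by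
    rw [tOne_eq, tZero_eq, hΦ]; ring
  rw [hval]
  -- Regularity does not exclude a zero of the denominator at η = 0. In that case `root_facts` with
  -- root 0 gives γ₁ = γ₂, hence γ₃ = γ₄ = 0 and G = 0; on (0,1] h agrees with the derivative of the
  -- F-part, which is continuous everywhere.
  by_cases hb : logArg ((0 : ℝ) • a + b) c = 0
  · obtain ⟨-, hα, -, h3, h4⟩ := root_facts ha hq' hc hb
    have hγ : gamma1 a b c - gamma2 a b c = 0 := by simpa [hq] using h4
    have hγ4 : gamma4 a b c = 0 := by rw [gamma4, hγ, mul_zero]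
    have hγ3 : gamma3 a b c = 0 := by simpa [hγ4] using h3
    have hd : ∀ η, HasDerivAt Φ (2 * qPar a b * ((gamma1 a b c / (1 - tPar a b η) +
        gamma2 a b c / (1 + tPar a b η)) * (qPar a b / (√((η + pPar a b) ^ 2 + qPar a b ^ 2) *
          (qPar a b + √((η + pPar a b) ^ 2 + qPar a b ^ 2)))))) η := by
      intro η
      have dt := hasDerivAt_tPar hq' η
      have e : Φ = fun η => 2 * qPar a b * antiF a b c (tPar a b η) := by
        ext η; simp [hΦ, antiG, hγ3, hγ4]
      rw [e]
      exact ((hasDerivAt_antiF a b c (neg_one_lt_tPar hq' _) (tPar_lt_one hq' _)).comp η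
        dt).const_mul _
    refine intervalIntegrable_and_integral_of_eqOn (fun η hη =>
      (hasDerivAt_antiF_add_antiG ha hq' hc (hreg η hη).ne').unique (hd η)) ?_
    have ht := continuous_tPar hq'
    have hcont : Continuous fun η => 2 * qPar a b * ((gamma1 a b c / (1 - tPar a b η) +
        gamma2 a b c / (1 + tPar a b η)) * (qPar a b / (√((η + pPar a b) ^ 2 + qPar a b ^ 2) *
          (qPar a b + √((η + pPar a b) ^ 2 + qPar a b ^ 2))))) := by
      refine continuous_const.mul (((continuous_const.div (by fun_prop) fun η => ?_).add
        (continuous_const.div (by fun_prop) fun η => ?_)).mul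
          (continuous_const.div (by fun_prop) fun η => ?_))
      · have := tPar_lt_one hq' η; linarith
      · have := neg_one_lt_tPar hq' η; linarith
      · have := root_pos hq' (η + pPar a b); positivity
    exact ⟨hcont.intervalIntegrable _ _, intervalIntegral.integral_eq_sub_of_hasDerivAt
      (fun η _ => hd η) (hcont.intervalIntegrable _ _)⟩
  · have hL : ∀ η ∈ uIcc (0 : ℝ) 1, logArg (η • a + b) c ≠ 0 := by
      intro η hη
      rw [uIcc_of_le zero_le_one] at hη
      rcases hη.1.eq_or_lt with h0 | h0
      · rwa [← h0]
      · exact (hreg η ⟨h0, hη.2⟩).ne'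
    have hcont : ContinuousOn (hFun a b c) (uIcc 0 1) := by
      rw [show hFun a b c = _ from funext (hFun_eq_div a b c)]
      refine ContinuousOn.div (by fun_prop) (by fun_prop) fun η hη => ?_
      have := hL η hη
      rw [logArg_eq hc] at this
      exact mul_ne_zero (norm_smul_add_pos ha hq' η).ne' (right_ne_zero_of_mul this)
    exact ⟨hcont.intervalIntegrable, intervalIntegral.integral_eq_sub_of_hasDerivAt
      (fun η hη => hasDerivAt_antiF_add_antiG ha hq' hc (hL η hη)) hcont.intervalIntegrable⟩

/-! ### The integral of the logarithm -/

lemma hasDerivAt_norm_smul_add (a b : E3) {η : ℝ} (hx : η • a + b ≠ 0) :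
    HasDerivAt (fun η : ℝ => ‖η • a + b‖) (inner ℝ (η • a + b) a / ‖η • a + b‖) η := by
  have h : HasDerivAt (fun η : ℝ => η • a + b) a η := by
    simpa using ((hasDerivAt_id η).smul_const a).add_const b
  have hn : ‖η • a + b‖ ≠ 0 := norm_ne_zero_iff.2 hx
  have := h.norm_sq.sqrt (by positivity)
  simp only [Real.sqrt_sq (norm_nonneg _)] at this
  refine this.congr_deriv ?_
  field_simp

lemma hasDerivAt_logArg (a b c : E3) {η : ℝ} (hx : η • a + b ≠ 0) :
    HasDerivAt (fun η : ℝ => logArg (η • a + b) c)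
      (inner ℝ (η • a + b) a / ‖η • a + b‖ * ‖c‖ + inner ℝ a c) η := by
  have h : HasDerivAt (fun η : ℝ => inner ℝ (η • a + b) c) (inner ℝ a c) η := by
    simp_rw [inner_add_left, inner_smul_left]
    simpa using ((hasDerivAt_id η).mul_const (inner ℝ a c)).add_const (inner ℝ b c)
  exact ((hasDerivAt_norm_smul_add a b hx).mul_const ‖c‖).add h

/-- As ηa = x − b, multiplying the derivative of `logArg` by η reproduces `logArg` up to terms
containing b, and these form the numerator of h. -/
lemma mul_deriv_logArg {a b c : E3} (hc : c ≠ 0) {η : ℝ} (hL : logArg (η • a + b) c ≠ 0) :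
    η * ((inner ℝ (η • a + b) a / ‖η • a + b‖ * ‖c‖ + inner ℝ a c) / logArg (η • a + b) c) =
      1 - hFun a b c η := by
  have hx : ‖η • a + b‖ ≠ 0 := by
    intro h; rw [norm_eq_zero] at h; simp [h, logArg] at hL
  have hn := norm_ne_zero_iff.2 hc
  have e1 : η * inner ℝ (η • a + b) a = ‖η • a + b‖ ^ 2 - inner ℝ (η • a + b) b := by
    rw [← real_inner_self_eq_norm_sq, ← inner_sub_right, add_sub_cancel_right, inner_smul_right]
  have e2 : η * inner ℝ a c = inner ℝ (η • a + b) c - inner ℝ b c := by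
    rw [← inner_sub_left, add_sub_cancel_right, inner_smul_left]; rfl
  have hden : ‖η • a + b‖ * (‖η • a + b‖ + inner ℝ (η • a + b) (hat c)) ≠ 0 := by
    rw [logArg_eq hc] at hL; exact mul_ne_zero hx (right_ne_zero_of_mul hL)
  rw [hFun_eq_div, one_sub_div hden, ← mul_div_assoc, div_eq_div_iff hL hden, mul_add, e2,
    logArg_eq hc, inner_eq_norm_mul_inner_hat hc, inner_eq_norm_mul_inner_hat hc]
  field_simp
  rw [e1]
  ring

lemma continuous_logArg_smul_add (a b c : E3) : Continuous fun η : ℝ => logArg (η • a + b) c :=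
  (continuous_logArg c).comp (by fun_prop)

lemma exists_log_logArg_le (a b c : E3) :
    ∃ C, ∀ η ∈ Icc (0 : ℝ) 1, Real.log (logArg (η • a + b) c) ≤ C := by
  obtain ⟨C, hC⟩ := (isCompact_Icc (a := (0 : ℝ)) (b := 1)).bddAbove_image
    (continuous_logArg_smul_add a b c).continuousOn
  exact ⟨C, fun η hη => (Real.log_le_self (logArg_nonneg _ _)).trans
    (hC (mem_image_of_mem _ hη))⟩

/-- The fundamental theorem of calculus for a derivative that is bounded above and undefined at
one point. -/
lemma integral_eq_sub_of_hasDerivAt_off_point {f M : ℝ → ℝ} {r C : ℝ} (hr : r ∈ Icc (0 : ℝ) 1)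
    (hM : ContinuousOn M (Icc 0 1)) (hd : ∀ η ∈ Ioo (0 : ℝ) 1, η ≠ r → HasDerivAt M (f η) η)
    (hC : ∀ η ∈ Icc (0 : ℝ) 1, f η ≤ C) :
    IntervalIntegrable f volume 0 1 ∧ ∫ η in (0 : ℝ)..1, f η = M 1 - M 0 := by
  -- The exceptional point is made an endpoint by treating [0,r] and [r,1] separately.
  have key : ∀ x y : ℝ, 0 ≤ x → x ≤ y → y ≤ 1 → (y ≤ r ∨ r ≤ x) →
      IntervalIntegrable f volume x y ∧ ∫ η in x..y, f η = M y - M x := by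
    intro x y hx hxy hy hxr
    have hM' : ContinuousOn M (Icc x y) := hM.mono (Icc_subset_Icc hx hy)
    have hd' : ∀ η ∈ Ioo x y, HasDerivAt M (f η) η := by
      intro η hη
      refine hd η ⟨hx.trans_lt hη.1, hη.2.trans_le hy⟩ ?_
      rintro rfl
      rcases hxr with h | h
      · exact absurd hη.2 (not_lt.2 h)
      · exact absurd hη.1 (not_lt.2 h)
    -- C − f is the nonnegative derivative of the continuous function Cη − M, hence integrable.
    have hint : IntervalIntegrable (fun η => C - f η) volume x y := by
      apply intervalIntegral.intervalIntegrable_deriv_of_nonneg (g := fun η => C * η - M η)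
      · rw [uIcc_of_le hxy]; exact (by fun_prop : ContinuousOn (fun η => C * η) _).sub hM'
      · intro η hη
        rw [min_eq_left hxy, max_eq_right hxy] at hη
        exact (((hasDerivAt_id η).const_mul C).sub (hd' η hη)).congr_deriv (by simp)
      · intro η hη
        rw [min_eq_left hxy, max_eq_right hxy] at hη
        exact sub_nonneg.2 (hC η ⟨hx.trans hη.1.le, hη.2.le.trans hy⟩)
    have hf : IntervalIntegrable f volume x y := by
      simpa using (intervalIntegrable_const (c := C)).sub hint
    exact ⟨hf, intervalIntegral.integral_eq_sub_of_hasDerivAt_of_le hxy hM' hd' hf⟩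
  obtain ⟨i1, e1⟩ := key 0 r le_rfl hr.1 hr.2 (Or.inl le_rfl)
  obtain ⟨i2, e2⟩ := key r 1 hr.1 hr.2 le_rfl (Or.inr le_rfl)
  refine ⟨i1.trans i2, ?_⟩
  rw [← intervalIntegral.integral_add_adjacent_intervals i1 i2, e1, e2]
  ring

/-- The antiderivative of the logarithm. -/
noncomputable def logPrim (a b c : E3) (η : ℝ) : ℝ := η * Real.log (logArg (η • a + b) c) - η +
  2 * qPar a b * (antiF a b c (tPar a b η) + antiG a b c (tPar a b η))

lemma hasDerivAt_logPrim {a b c : E3} (ha : a ≠ 0) (hq : 0 < qPar a b) (hc : c ≠ 0) {η : ℝ}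
    (hL : logArg (η • a + b) c ≠ 0) :
    HasDerivAt (logPrim a b c) (Real.log (logArg (η • a + b) c)) η := by
  have hx : η • a + b ≠ 0 := norm_pos_iff.1 (norm_smul_add_pos ha hq η)
  refine ((((hasDerivAt_id η).mul ((hasDerivAt_logArg a b c hx).log hL)).sub
    (hasDerivAt_id η)).add (hasDerivAt_antiF_add_antiG ha hq hc hL)).congr_deriv ?_
  simp only [id]
  rw [mul_deriv_logArg hc hL]
  ring

lemma logPrim_one_sub_zero {a b c : E3} (ha : a ≠ 0) (hq : 0 < qPar a b) :
    logPrim a b c 1 - logPrim a b c 0 = Real.log (logArg (a + b) c) - 1 + hClosed a b c := by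
  rw [hClosed, if_neg ha, if_neg hq.ne', logPrim, logPrim, tOne_eq, tZero_eq]
  simp
  ring

/-! ### Continuation of the antiderivative through a zero of `logArg` -/

section
variable {a b c : E3} (ha : a ≠ 0) (hq : 0 < qPar a b) (hc : c ≠ 0)
include ha hq hc

/-- Any such parameter corresponds to the double root t = −α₁/(2α₂), and t determines η. -/
lemma eq_of_logArg_eq_zero {η r : ℝ} (hη : logArg (η • a + b) c = 0)
    (hr : logArg (r • a + b) c = 0) : η = r := by
  obtain ⟨-, hα, h1, -⟩ := root_facts ha hq hc hη
  obtain ⟨-, -, h2, -⟩ := root_facts ha hq hc hr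
  have ht : tPar a b η = tPar a b r := by
    apply mul_left_cancel₀ (mul_ne_zero two_ne_zero hα); linarith
  have e1 := eq_of_tSub hq (η + pPar a b)
  have e2 := eq_of_tSub hq (r + pPar a b)
  unfold tPar at ht
  rw [ht, ← e2] at e1
  linarith

/-- D = 0 gives 4α₀α₂ = α₁² ≥ 0, while α₀ + α₂ = 2q|a| ≥ 0. -/
lemma alpha2_pos_of_logArg_eq_zero {r : ℝ} (hr : logArg (r • a + b) c = 0) :
    0 < alpha2 a b c := by
  obtain ⟨hD, hα, -⟩ := root_facts ha hq hc hr
  refine lt_of_le_of_ne ?_ hα.symm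
  rw [disc] at hD
  have h0 : alpha0 a b c + alpha2 a b c = 2 * qPar a b * ‖a‖ := by
    rw [alpha0_eq, alpha2_eq]; ring
  have : 0 ≤ qPar a b * ‖a‖ := by positivity
  nlinarith [sq_nonneg (alpha1 a b c), sq_nonneg (alpha2 a b c)]

/-- The antiderivative of the logarithm, extended continuously to the root of its argument. -/
lemma exists_continuous_logPrim {r : ℝ} (hr : logArg (r • a + b) c = 0) :
    ∃ M : ℝ → ℝ, Continuous M ∧ (∀ η, η ≠ r → M η = logPrim a b c η) ∧
      (r = 0 → M 0 = logPrim a b c 0) := by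
  obtain ⟨hD, hα, hroot, hγ, hcoef⟩ := root_facts ha hq hc hr
  have hα' := alpha2_pos_of_logArg_eq_zero ha hq hc hr
  have hcn : 0 < ‖c‖ := norm_pos_iff.2 hc
  have hroot' : alpha1 a b c / (2 * alpha2 a b c) = -tPar a b r := by
    field_simp; linarith
  -- γ₃ + γ₄t_r = 0 removes the rational term of G, and q(γ₁−γ₂) = −r gives the coefficient of the
  -- logarithm. The branch G = 0 occurs only for r = 0.
  have hG : ∀ η, 2 * qPar a b * antiG a b c (tPar a b η) =
      -2 * r * Real.log |tPar a b η - tPar a b r| := by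
    intro η
    rw [antiG]
    split_ifs with h h'
    · have h4 : gamma4 a b c = 0 := (h.resolve_left hα).2
      rw [gamma4, mul_eq_zero] at h4
      have : r = 0 := by
        rw [h4.resolve_left hα, mul_zero] at hcoef; linarith
      rw [this]; simp
    · exact absurd h' (by rw [hD]; simp)
    · have h3 : 2 * gamma3 a b c * alpha2 a b c - gamma4 a b c * alpha1 a b c = 0 := by
        linear_combination 2 * alpha2 a b c * hγ - gamma4 a b c * hroot
      rw [h3, hroot', zero_div, sub_zero, gamma4, mul_div_cancel_left₀ _ hα, ← sub_eq_add_neg]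
      linear_combination 2 * Real.log |tPar a b η - tPar a b r| * hcoef
  -- By η + p = 2qt/(1−t²), η − r is t − t_r times a continuous factor.
  have hdiff : ∀ η, (η - r) * ((1 - tPar a b η ^ 2) * (1 - tPar a b r ^ 2)) =
      2 * qPar a b * (1 + tPar a b η * tPar a b r) * (tPar a b η - tPar a b r) := by
    intro η
    have e1 := eq_of_tSub hq (η + pPar a b)
    have e2 := eq_of_tSub hq (r + pPar a b)
    have p1 := (one_sub_tPar_sq_pos hq η).ne'
    have p2 := (one_sub_tPar_sq_pos hq r).ne'
    change _ = 2 * qPar a b * tPar a b η / (1 - tPar a b η ^ 2) at e1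
    change _ = 2 * qPar a b * tPar a b r / (1 - tPar a b r ^ 2) at e2
    rw [eq_div_iff p1] at e1
    rw [eq_div_iff p2] at e2
    linear_combination (1 - tPar a b r ^ 2) * e1 - (1 - tPar a b η ^ 2) * e2
  have ht := continuous_tPar hq
  -- ln `logArg` contributes 2η ln|t−t_r| and G contributes −2r ln|t−t_r|. By `hdiff` their sum is a
  -- continuous multiple of (t−t_r) ln|t−t_r|, which is continuous with value 0 at the root.
  refine ⟨fun η => η * (Real.log ‖c‖ + Real.log (alpha2 a b c) - Real.log (1 - tPar a b η ^ 2)) - η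
    + 2 * qPar a b * antiF a b c (tPar a b η) +
    2 * (2 * qPar a b * (1 + tPar a b η * tPar a b r) /
      ((1 - tPar a b η ^ 2) * (1 - tPar a b r ^ 2))) *
      ((tPar a b η - tPar a b r) * Real.log (tPar a b η - tPar a b r)), ?_, ?_, ?_⟩
  · have c1 : Continuous fun η => antiF a b c (tPar a b η) :=
      continuous_iff_continuousAt.2 fun η => ContinuousAt.comp (f := tPar a b)
        (hasDerivAt_antiF a b c (neg_one_lt_tPar hq η) (tPar_lt_one hq η)).continuousAt
        ht.continuousAt
    have c2 : Continuous fun η => Real.log (1 - tPar a b η ^ 2) :=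
      Continuous.log (by fun_prop) fun η => (one_sub_tPar_sq_pos hq η).ne'
    have c3 : Continuous fun η =>
        (tPar a b η - tPar a b r) * Real.log (tPar a b η - tPar a b r) :=
      Real.continuous_mul_log.comp (ht.sub continuous_const)
    have c4 : Continuous fun η => 2 * qPar a b * (1 + tPar a b η * tPar a b r) /
      ((1 - tPar a b η ^ 2) * (1 - tPar a b r ^ 2)) :=
      Continuous.div (by fun_prop) (by fun_prop) fun η =>
        (mul_pos (one_sub_tPar_sq_pos hq η) (one_sub_tPar_sq_pos hq r)).ne'
    fun_prop
  · intro η hη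
    have p1 := one_sub_tPar_sq_pos hq η
    have p2 := one_sub_tPar_sq_pos hq r
    have hL : logArg (η • a + b) c ≠ 0 := fun h => hη (eq_of_logArg_eq_zero ha hq hc h hr)
    have hA := (quadA_tPar_eq_zero_iff ha hq hc η).not.2 hL
    have hAsq : quadA a b c (tPar a b η) = alpha2 a b c * (tPar a b η - tPar a b r) ^ 2 := by
      apply mul_left_cancel₀ (mul_ne_zero four_ne_zero hα)
      rw [quadA]; rw [disc] at hD
      have h1 : alpha1 a b c = -(2 * alpha2 a b c * tPar a b r) := by linarith
      rw [h1] at hD ⊢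
      linear_combination hD
    have htt : tPar a b η - tPar a b r ≠ 0 := by
      intro h; rw [hAsq, h] at hA; simp at hA
    have hlog : Real.log (logArg (η • a + b) c) = Real.log ‖c‖ + Real.log (alpha2 a b c) +
        2 * Real.log (tPar a b η - tPar a b r) - Real.log (1 - tPar a b η ^ 2) := by
      have : logArg (η • a + b) c = ‖c‖ * (alpha2 a b c * (tPar a b η - tPar a b r) ^ 2) /
          (1 - tPar a b η ^ 2) := by
        rw [← hAsq, quadA_tPar ha hq, logArg_eq hc]
        field_simp
      rw [this, Real.log_div (by positivity) p1.ne', Real.log_mul hcn.ne' (by positivity),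
        Real.log_mul hα (by positivity), Real.log_pow]
      push_cast
      ring
    have hq2 : 2 * qPar a b * (1 + tPar a b η * tPar a b r) /
      ((1 - tPar a b η ^ 2) * (1 - tPar a b r ^ 2)) = (η - r) / (tPar a b η - tPar a b r) := by
      rw [div_eq_div_iff (by positivity) htt]
      exact (hdiff η).symm
    have hG' := hG η
    rw [Real.log_abs] at hG'
    simp only [logPrim]
    rw [hq2, hlog, mul_add (2 * qPar a b), hG']
    field_simp
    ring
  -- At η = r = 0 both singular logarithms have coefficient 0, so the default value of `Real.log 0`
  -- is harmless.
  · rintro rfl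
    simp only [logPrim, mul_add, hG]
    simp

end

/-- The integral of the logarithm of `logArg` along a segment that avoids the origin. -/
theorem integral_log_logArg {a b c : E3} (hc : c ≠ 0)
    (hx : ∀ η ∈ Icc (0 : ℝ) 1, η • a + b ≠ 0) (h1 : 0 < logArg (a + b) c) :
    IntervalIntegrable (fun η : ℝ => Real.log (logArg (η • a + b) c)) volume 0 1 ∧
      (∫ η in (0 : ℝ)..1, Real.log (logArg (η • a + b) c)) =
        Real.log (logArg (a + b) c) - 1 + hClosed a b c ∧
      {η ∈ Icc (0 : ℝ) 1 | logArg (η • a + b) c = 0}.Countable := by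
  by_cases ha : a = 0
  · subst ha
    rw [zero_add] at h1
    simp [hClosed, h1.ne']
  rcases (qPar_nonneg a b).eq_or_lt with hq | hq
  -- For q = 0 the segment lies on a line through the origin and avoids the origin, so its points
  -- are positive multiples of a + b, and `logArg` is positively homogeneous in x.
  · have hb := smul_add_eq_of_qPar ha hq.symm
    rw [hClosed, if_neg ha, if_pos hq.symm]
    generalize pPar a b = p at hb
    have hxs : ∀ η : ℝ, η • a + b = (η + p) • a := fun η => by rw [hb, add_smul]
    have hs : ∀ η ∈ Icc (0 : ℝ) 1, η + p ≠ 0 := fun η hη h => hx η hη (by rw [hxs, h, zero_smul])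
    have h1p : 1 + p ≠ 0 := hs 1 (by simp)
    have h0p : p ≠ 0 := by simpa using hs 0 (by simp)
    have hpos : ∀ η ∈ Icc (0 : ℝ) 1, 0 < (η + p) / (1 + p) := by
      intro η hη
      rcases lt_or_gt_of_ne h0p with hp | hp
      · have : 1 + p < 0 := by
          by_contra h
          exact hs (-p) ⟨by linarith, by linarith⟩ (by ring)
        exact div_pos_of_neg_of_neg (by linarith [hη.2]) this
      · exact div_pos (by linarith [hη.1]) (by linarith)
    have hLeq : ∀ η ∈ Icc (0 : ℝ) 1,
        logArg (η • a + b) c = (η + p) / (1 + p) * logArg (a + b) c := by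
      intro η hη
      have e : η • a + b = ((η + p) / (1 + p)) • (a + b) := by
        have := hxs 1
        rw [one_smul] at this
        rw [this, hxs, smul_smul, div_mul_cancel₀ _ h1p]
      rw [e, logArg, logArg, norm_smul, inner_smul_left, Real.norm_of_nonneg (hpos η hη).le]
      simp only [RCLike.conj_to_real]
      ring
    have hset : {η ∈ Icc (0 : ℝ) 1 | logArg (η • a + b) c = 0} = ∅ := by
      rw [eq_empty_iff_forall_notMem]
      rintro η ⟨hη, h0⟩
      rw [hLeq η hη] at h0
      exact (mul_pos (hpos η hη) h1).ne' h0
    rw [hset, ← and_assoc]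
    refine ⟨?_, countable_empty⟩
    refine intervalIntegrable_and_integral_of_eqOn (f := fun η => Real.log (η + p) -
      Real.log (1 + p) + Real.log (logArg (a + b) c)) (fun η hη => ?_) ?_
    · have hη' := Ioc_subset_Icc_self hη
      rw [hLeq η hη', Real.log_mul (hpos η hη').ne' h1.ne', Real.log_div (hs η hη') h1p]
    · have hi : IntervalIntegrable (fun η : ℝ => Real.log (η + p)) volume 0 1 := by
        refine ContinuousOn.intervalIntegrable ?_
        rw [uIcc_of_le zero_le_one]
        exact ContinuousOn.log (by fun_prop) hs
      refine ⟨(hi.sub intervalIntegrable_const).add intervalIntegrable_const, ?_⟩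
      rw [intervalIntegral.integral_add (hi.sub intervalIntegrable_const) intervalIntegrable_const,
        intervalIntegral.integral_sub hi intervalIntegrable_const,
        intervalIntegral.integral_comp_add_right (fun x => Real.log x), integral_log,
        show 1 + 1 / p = (1 + p) / p by field_simp; ring, Real.log_div h1p h0p]
      simp
      ring
  rw [← logPrim_one_sub_zero ha hq]
  obtain ⟨C, hC⟩ := exists_log_logArg_le a b c
  by_cases hz : ∃ r ∈ Icc (0 : ℝ) 1, logArg (r • a + b) c = 0
  · obtain ⟨r, hr, hr0⟩ := hz
    have hset : {η ∈ Icc (0 : ℝ) 1 | logArg (η • a + b) c = 0} ⊆ {r} := fun η hη =>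
      eq_of_logArg_eq_zero ha hq hc hη.2 hr0
    rw [← and_assoc]
    refine ⟨?_, (countable_singleton r).mono hset⟩
    obtain ⟨M, hM, hM1, hM0⟩ := exists_continuous_logPrim ha hq hc hr0
    -- The root is not 1 by `h1`, and r = 0 is covered by the last property of M, so both endpoint
    -- values agree with `logPrim`.
    have e1 : M 1 = logPrim a b c 1 := by
      refine hM1 1 ?_
      rintro rfl
      rw [one_smul] at hr0; exact h1.ne' hr0
    have e0 : M 0 = logPrim a b c 0 := by
      by_cases h : r = 0
      · exact hM0 h
      · exact hM1 0 (Ne.symm h)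
    rw [← e1, ← e0]
    refine integral_eq_sub_of_hasDerivAt_off_point hr hM.continuousOn (fun η _ hηr => ?_) hC
    have hL : logArg (η • a + b) c ≠ 0 := fun h => hηr (eq_of_logArg_eq_zero ha hq hc h hr0)
    refine (hasDerivAt_logPrim ha hq hc hL).congr_of_eventuallyEq ?_
    filter_upwards [isOpen_ne.mem_nhds hηr] with y hy using hM1 y hy
  · push Not at hz
    have hset : {η ∈ Icc (0 : ℝ) 1 | logArg (η • a + b) c = 0} = ∅ :=
      eq_empty_iff_forall_notMem.2 fun η hη => hz η hη.1 hη.2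
    rw [hset, ← and_assoc]
    refine ⟨?_, countable_empty⟩
    exact integral_eq_sub_of_hasDerivAt_off_point (r := 0) (by simp)
      (fun η hη => (hasDerivAt_logPrim ha hq hc (hz η hη)).continuousAt.continuousWithinAt)
      (fun η hη _ => hasDerivAt_logPrim ha hq hc (hz η (Ioo_subset_Icc_self hη))) hC

/-! ### Reduction of the integrals over the square to integrals of logarithms -/

lemma logArg_smul_add_pos {y c : E3} (hc : c ≠ 0) (hy : 0 < logArg y c) {s : ℝ} (hs : 0 ≤ s) :
    0 < logArg (s • c + y) c := by
  rw [logArg_pos_iff hc] at hy ⊢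
  intro l hl h
  refine hy (l + s) (by positivity) ?_
  rw [add_smul, neg_add, ← h]
  abel

/-- The derivative of `logArg` in the direction c is (x·c/|x|)|c| + |c|² = |c| `logArg`/|x|, so ln
`logArg`/|c| is an antiderivative of 1/|x| in that direction. -/
lemma integral_div_norm {y c : E3} (hc : c ≠ 0) (hy : 0 < logArg y c) {S : ℝ} (hS : 0 ≤ S) :
    ∫ s in (0 : ℝ)..1, S / ‖(s * S) • c + y‖ =
      1 / ‖c‖ * (Real.log (logArg (S • c + y) c) - Real.log (logArg y c)) := by
  have hcn : ‖c‖ ≠ 0 := norm_ne_zero_iff.2 hc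
  have hpos : ∀ s ∈ uIcc (0 : ℝ) 1, 0 < logArg (s • (S • c) + y) c := by
    intro s hs
    rw [uIcc_of_le zero_le_one] at hs
    rw [smul_smul]
    exact logArg_smul_add_pos hc hy (mul_nonneg hs.1 hS)
  have hx : ∀ s ∈ uIcc (0 : ℝ) 1, s • (S • c) + y ≠ 0 := by
    intro s hs h
    have := hpos s hs
    rw [h] at this
    simp [logArg] at this
  have hd : ∀ s ∈ uIcc (0 : ℝ) 1, HasDerivAt
      (fun s : ℝ => 1 / ‖c‖ * Real.log (logArg (s • (S • c) + y) c))
      (S / ‖(s * S) • c + y‖) s := by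
    intro s hs
    refine (((hasDerivAt_logArg (S • c) y c (hx s hs)).log
      (hpos s hs).ne').const_mul (1 / ‖c‖)).congr_deriv ?_
    have h1 := norm_ne_zero_iff.2 (hx s hs)
    have h2 := (hpos s hs).ne'
    rw [smul_smul] at h1 h2 ⊢
    rw [inner_smul_right, inner_smul_left, real_inner_self_eq_norm_sq]
    simp only [RCLike.conj_to_real]
    rw [logArg] at h2 ⊢
    generalize (s * S) • c + y = x at h1 h2 ⊢
    rw [one_div_mul_eq_div, div_div, div_eq_div_iff (by positivity) h1]
    field_simp
    ring
  have hcont : ContinuousOn (fun s : ℝ => S / ‖(s * S) • c + y‖) (uIcc 0 1) :=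
    ContinuousOn.div (by fun_prop) (by fun_prop) fun s hs => by
      rw [mul_smul]; exact norm_ne_zero_iff.2 (hx s hs)
  rw [intervalIntegral.integral_eq_sub_of_hasDerivAt hd hcont.intervalIntegrable]
  simp
  ring

/-- For fixed η the point moves in direction c from ηa' + b' to ηa + b as s runs from 0 to 1; S is
the weight, 1 for I₁ and η₃ for the others. The constants −1 of the two logarithmic integrals
cancel. -/
lemma setIntegral_unitSquare_eq {a b a' b' c : E3} (hc : c ≠ 0) {f : ℝ × ℝ → ℝ} {S : ℝ → ℝ}
    (hf : IntegrableOn f unitSquare)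
    (hfS : ∀ η s, f (η, s) = S η / ‖(s * S η) • c + (η • a' + b')‖)
    (hS : ∀ η ∈ Ioo (0 : ℝ) 1, 0 ≤ S η) (hab : ∀ η : ℝ, S η • c + (η • a' + b') = η • a + b)
    (hx : ∀ η ∈ Icc (0 : ℝ) 1, η • a + b ≠ 0) (hx' : ∀ η ∈ Icc (0 : ℝ) 1, η • a' + b' ≠ 0)
    (h1 : 0 < logArg (a + b) c) (h1' : 0 < logArg (a' + b') c) :
    ∫ z in unitSquare, f z = 1 / ‖c‖ * Real.log (logArg (a + b) c / logArg (a' + b') c) -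
      1 / ‖c‖ * (hClosed a' b' c - hClosed a b c) := by
  obtain ⟨i, e, -⟩ := integral_log_logArg hc hx h1
  obtain ⟨i', e', hcount⟩ := integral_log_logArg hc hx' h1'
  have key : ∀ᵐ η ∂(volume.restrict (Ioo (0 : ℝ) 1)), ∫ s in Ioo (0 : ℝ) 1, f (η, s) =
      1 / ‖c‖ * (Real.log (logArg (η • a + b) c) - Real.log (logArg (η • a' + b') c)) := by
    rw [ae_restrict_iff' measurableSet_Ioo]
    -- The inner antiderivative is unavailable only for the countably many η with ηa' + b' on the
    -- ray {−lc : l ≥ 0}.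
    filter_upwards [(measure_eq_zero_iff_ae_notMem.1 (hcount.measure_zero volume))] with η hη hη1
    have hpos : 0 < logArg (η • a' + b') c :=
      (logArg_nonneg _ _).lt_of_ne' fun h => hη ⟨Ioo_subset_Icc_self hη1, h⟩
    rw [← hab, ← integral_div_norm hc hpos (hS η hη1), intervalIntegral.integral_of_le zero_le_one,
      integral_Ioc_eq_integral_Ioo]
    simp_rw [hfS]
  have hf' : IntegrableOn f (Ioo (0 : ℝ) 1 ×ˢ Ioo (0 : ℝ) 1) (volume.prod volume) := hf
  have hprod : ∫ z in unitSquare, f z = ∫ η in Ioo (0 : ℝ) 1, ∫ s in Ioo (0 : ℝ) 1, f (η, s) :=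
    setIntegral_prod f hf'
  rw [hprod, integral_congr_ae key, ← integral_Ioc_eq_integral_Ioo,
    ← intervalIntegral.integral_of_le zero_le_one, intervalIntegral.integral_const_mul,
    intervalIntegral.integral_sub i i', e, e', Real.log_div h1.ne' h1'.ne']
  ring

/-! ### Two triangles with a common edge -/

/-- The differences of points of the two triangles vanish only on the common edge. -/
def EdgeCone (u v w : E3) : Prop :=
  ∀ z Y X : ℝ, 0 ≤ Y → 0 ≤ X → z • v + Y • u - X • w = 0 → z = 0 ∧ Y = 0 ∧ X = 0

lemma gramRoot_eq (e f : E3) : gramRoot e f = √(‖e‖ ^ 2 * ‖f‖ ^ 2 - inner ℝ e f ^ 2) := by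
  unfold gramRoot
  congr 1
  rw [Matrix.det_fin_two]
  simp only [Matrix.mul_apply, Matrix.transpose_apply, jacobian, Matrix.of_apply,
    Fin.sum_univ_three, EuclideanSpace.norm_sq_eq, PiLp.inner_apply, Real.norm_eq_abs, sq_abs,
    RCLike.inner_apply, RCLike.conj_to_real, Matrix.cons_val_zero, Matrix.cons_val_one]
  ring

lemma eq_zero_of_gramRoot {e f : E3} (h : gramRoot e f ≠ 0) {x y : ℝ}
    (hxy : x • e + y • f = 0) : x = 0 ∧ y = 0 := by
  rw [gramRoot_eq] at h
  have hy : y = 0 := by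
    by_contra hy
    have hf : f = (-x / y) • e := by
      have h1 : f = y⁻¹ • (y • f) := by rw [smul_smul, inv_mul_cancel₀ hy, one_smul]
      rw [h1, eq_neg_of_add_eq_zero_right hxy, ← neg_smul, smul_smul]
      ring_nf
    apply h
    rw [hf, norm_smul, inner_smul_right, real_inner_self_eq_norm_sq, mul_pow, Real.norm_eq_abs,
      sq_abs]
    ring_nf
    simp
  refine ⟨?_, hy⟩
  by_contra hx
  rw [hy, zero_smul, add_zero, smul_eq_zero] at hxy
  apply h
  rw [hxy.resolve_left hx]
  simp

lemma mem_closedTriangle (p e f : E3) {x y : ℝ} (hy : 0 ≤ y) (hyx : y ≤ x) (hx : x ≤ 1) :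
    p + x • e + y • f ∈ closedTriangle p e f := by
  have h : p + x • e + y • f = ∑ i, ![1 - x, x - y, y] i • ![p, p + e, p + e + f] i := by
    simp [Fin.sum_univ_three]
    module
  rw [h, closedTriangle]
  refine (convex_convexHull ℝ _).sum_mem (fun i _ => ?_) ?_ (fun i _ => subset_convexHull ℝ _ ?_)
  · fin_cases i <;> simp <;> linarith
  · simp [Fin.sum_univ_three]
  · fin_cases i <;> simp

/-- A relation zv + Yu = Xw, scaled by a small ε and based at the midpoint of the common edge, gives
a point of both closed triangles. It lies on the edge, so X = 0 because v, w are independent, and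
then z = Y = 0 because v, u are. -/
lemma edgeCone_of_inter {p u v w : E3} (hu : gramRoot v u ≠ 0) (hw : gramRoot v w ≠ 0)
    (h : closedTriangle p v u ∩ closedTriangle p v w = segment ℝ p (p + v)) :
    EdgeCone u v w := by
  intro z Y X hY hX h0
  set ε : ℝ := 1 / (4 * (1 + |z| + Y + X)) with hε
  have hpos : 0 < 1 + |z| + Y + X := by positivity
  have hε0 : 0 < ε := by positivity
  have hε1 : ε * |z| + ε * Y + ε * X ≤ 1 / 4 := by
    have : ε * (1 + |z| + Y + X) = 1 / 4 := by rw [hε]; field_simp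
    nlinarith
  have hεY : 0 ≤ ε * Y := by positivity
  have hεX : 0 ≤ ε * X := by positivity
  have hz := abs_le.1 (abs_mul ε z ▸ (by rw [abs_of_pos hε0]; linarith) : |ε * z| ≤ 1 / 4)
  have m1 := mem_closedTriangle p v u (x := 1 / 2 + ε * z) (y := ε * Y) hεY
    (by nlinarith [abs_nonneg z]) (by linarith)
  have m2 := mem_closedTriangle p v w (x := 1 / 2) (y := ε * X) hεX
    (by nlinarith [abs_nonneg z]) (by norm_num)
  have e : p + (1 / 2 + ε * z) • v + (ε * Y) • u = p + (1 / 2 : ℝ) • v + (ε * X) • w := by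
    linear_combination (norm := module) ε • h0
  rw [e] at m1
  have m : p + (1 / 2 : ℝ) • v + (ε * X) • w ∈ segment ℝ p (p + v) := h ▸ ⟨m1, m2⟩
  rw [segment_eq_image'] at m
  obtain ⟨s, -, hs⟩ := m
  have h1 : (1 / 2 - s) • v + (ε * X) • w = 0 := by
    simp only [add_sub_cancel_left] at hs
    linear_combination (norm := module) -hs
  have hX0 : X = 0 := by simpa [hε0.ne'] using (eq_zero_of_gramRoot hw h1).2
  rw [hX0, zero_smul, sub_zero] at h0
  obtain ⟨h2, h3⟩ := eq_zero_of_gramRoot hu h0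
  exact ⟨h2, h3, hX0⟩

section
variable {u v w : E3} (h : EdgeCone u v w)
include h

lemma EdgeCone.smul_add_ne_zero (j : Fin 5) {η : ℝ} (hη : η ∈ Icc (0 : ℝ) 1) :
    η • parA u v w j + parB u v w j ≠ 0 := by
  intro h0
  have h1 := hη.1
  have h2 := sub_nonneg.2 hη.2
  fin_cases j <;> simp [parA, parB] at h0
  · have := (h (-1) 0 η le_rfl h1 (by linear_combination (norm := module) -h0)).1
    norm_num at this
  · have := (h (-η) 0 1 le_rfl zero_le_one (by linear_combination (norm := module) -h0)).2.2
    norm_num at this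
  · have := (h η 1 0 zero_le_one le_rfl (by linear_combination (norm := module) h0)).2.1
    norm_num at this
  all_goals
    obtain ⟨h3, -, h4⟩ := h η η (1 - η) h1 h2 (by linear_combination (norm := module) h0)
    linarith

lemma EdgeCone.smul_add_ne_zero' (j : Fin 5) {η : ℝ} (hη : η ∈ Icc (0 : ℝ) 1) :
    η • parA' u v w j + parB' u v w j ≠ 0 := by
  intro h0
  have h1 := hη.1
  have h2 := sub_nonneg.2 hη.2
  fin_cases j <;> simp [parA', parB', parA, parB, parC] at h0
  · have := (h 0 1 η zero_le_one h1 (by linear_combination (norm := module) -h0)).2.1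
    norm_num at this
  · have := (h 0 η 1 h1 zero_le_one (by linear_combination (norm := module) -h0)).2.2
    norm_num at this
  · have := (h 0 1 η zero_le_one h1 (by linear_combination (norm := module) h0)).2.1
    norm_num at this
  · obtain ⟨h3, -, h4⟩ := h η 0 (1 - η) le_rfl h2 (by linear_combination (norm := module) h0)
    linarith
  · have := (h 0 η 1 h1 zero_le_one (by linear_combination (norm := module) h0)).2.2
    norm_num at this

lemma EdgeCone.parC_ne_zero (j : Fin 5) : parC u v w j ≠ 0 := by
  intro h0
  fin_cases j <;> simp [parC] at h0
  · have := (h 1 1 0 zero_le_one le_rfl (by linear_combination (norm := module) h0)).1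
    norm_num at this
  · have := (h 1 1 0 zero_le_one le_rfl (by linear_combination (norm := module) h0)).1
    norm_num at this
  · have := (h (-1) 0 1 le_rfl zero_le_one (by linear_combination (norm := module) -h0)).1
    norm_num at this
  · have := (h 0 1 0 zero_le_one le_rfl (by linear_combination (norm := module) h0)).2.1
    norm_num at this
  · have := (h (-1) 0 1 le_rfl zero_le_one (by linear_combination (norm := module) -h0)).1
    norm_num at this

/-- On the closed square every vector under the norm is, up to sign, zv + Yu − Xw with Y, X ≥ 0 and
coefficients not all zero; hence the integrands are continuous on a compact set. -/
lemma EdgeCone.integrableOn_edgeIntegrand (j : Fin 5) :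
    IntegrableOn (edgeIntegrand u v w j) unitSquare := by
  have hsub : unitSquare ⊆ Icc (0 : ℝ) 1 ×ˢ Icc (0 : ℝ) 1 :=
    prod_mono Ioo_subset_Icc_self Ioo_subset_Icc_self
  refine (ContinuousOn.integrableOn_compact (isCompact_Icc.prod isCompact_Icc) ?_).mono_set hsub
  have hz : ∀ z ∈ Icc (0 : ℝ) 1 ×ˢ Icc (0 : ℝ) 1, 0 ≤ z.1 ∧ 0 ≤ 1 - z.1 ∧ 0 ≤ z.2 ∧
      0 ≤ z.1 * (1 - z.2) ∧ 0 ≤ 1 - z.2 * z.1 ∧ 0 ≤ z.2 * z.1 := by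
    rintro ⟨x, y⟩ ⟨⟨h1, h2⟩, h3, h4⟩
    dsimp only at h1 h2 h3 h4 ⊢
    exact ⟨h1, by linarith, h3, mul_nonneg h1 (by linarith), by nlinarith, mul_nonneg h3 h1⟩
  fin_cases j <;> simp only [Fin.zero_eta, Fin.mk_one, Fin.reduceFinMk] <;>
    refine ContinuousOn.div (by fun_prop) (by fun_prop) fun z hz' =>
      norm_ne_zero_iff.2 fun h0 => ?_ <;>
    obtain ⟨h1, h2, h3, h4, h5, h6⟩ := hz z hz'
  · obtain ⟨h7, h8, -⟩ := h (-z.1) (1 - z.1) z.2 h2 h3 (by linear_combination (norm := module) -h0)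
    linarith
  · obtain ⟨-, -, h7⟩ := h (-(z.2 * z.1)) (z.1 * (1 - z.2)) 1 h4 zero_le_one
      (by linear_combination (norm := module) -h0)
    norm_num at h7
  · obtain ⟨-, h7, -⟩ := h (z.2 * z.1) 1 (z.1 * (1 - z.2)) zero_le_one h4
      (by linear_combination (norm := module) h0)
    norm_num at h7
  · obtain ⟨h7, -, h8⟩ := h z.1 (z.2 * z.1) (1 - z.1) h6 h2
      (by linear_combination (norm := module) h0)
    linarith
  · obtain ⟨h7, -, h8⟩ := h (z.2 * z.1) z.1 (1 - z.2 * z.1) h1 h5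
      (by linear_combination (norm := module) h0)
    linarith

/-- The closed form of the integrals `I₁, …, I₅`. -/
theorem EdgeCone.edgeIntegral_eq {j : Fin 5} (hj : LogDefined u v w j) :
    edgeIntegral u v w j = edgeFormula hClosed u v w j := by
  have hc := h.parC_ne_zero j
  have hsum : parA u v w j + parB u v w j - parC u v w j = parA' u v w j + parB' u v w j := by
    rw [parA', parB']; split_ifs <;> abel
  obtain ⟨h1, h1'⟩ := hj
  rw [hsum] at h1'
  have hi := h.integrableOn_edgeIntegrand j
  rw [edgeFormula, hsum, edgeIntegral]
  by_cases hj0 : j = 0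
  · subst hj0
    -- In I₁ the variable multiplying c is η₃, so the coordinates are exchanged.
    have hswap : ∫ z in unitSquare, edgeIntegrand u v w 0 z =
        ∫ z in unitSquare, edgeIntegrand u v w 0 z.swap :=
      (setIntegral_prod_swap (μ := volume) (ν := volume) (Ioo (0 : ℝ) 1) (Ioo (0 : ℝ) 1)
        (edgeIntegrand u v w 0)).symm
    rw [hswap]
    refine setIntegral_unitSquare_eq hc (S := fun _ => 1) (IntegrableOn.swap hi) (fun η s => ?_)
      (fun _ _ => zero_le_one) (fun η => ?_) (fun _ => h.smul_add_ne_zero 0)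
      (fun _ => h.smul_add_ne_zero' 0) h1 h1'
    · simp [edgeIntegrand, parA', parB', parA, parB, parC, add_sub_assoc]
      rw [sub_eq_add_neg]
    · simp [parA', parB', parA, parB, parC]
      abel
  · refine setIntegral_unitSquare_eq hc (S := fun η => η) hi (fun η s => ?_)
      (fun _ hη => hη.1.le) (fun η => ?_) (fun _ => h.smul_add_ne_zero j)
      (fun _ => h.smul_add_ne_zero' j) h1 h1'
    · fin_cases j
      · exact absurd rfl hj0
      all_goals
        simp [edgeIntegrand, parA', parB', parA, parB, parC]
        congr 2
        module
    · rw [parA', parB', if_neg hj0, if_neg hj0]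
      module

/-- If β and γ have the same sign, division by β + γ exhibits p as a convex combination of the
opposite vertices; otherwise the relation contradicts `EdgeCone`. -/
lemma EdgeCone.relation_ne_zero {p : E3} (hp : p ∉ segment ℝ (p + v + u) (p + v + w)) {β γ : ℝ}
    (hβγ : β ≠ 0 ∨ γ ≠ 0) : (β + γ) • v + β • u + γ • w ≠ 0 := by
  have key : ∀ β γ : ℝ, 0 ≤ β → (β ≠ 0 ∨ γ ≠ 0) → (β + γ) • v + β • u + γ • w ≠ 0 := by
    intro β γ hβ hβγ h0
    rcases le_or_gt 0 γ with hγ | hγ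
    · have hpos : 0 < β + γ := by
        rcases hβγ with h1 | h1
        · have := hβ.lt_of_ne' h1; linarith
        · have := hγ.lt_of_ne' h1; linarith
      refine hp ⟨β / (β + γ), γ / (β + γ), by positivity, by positivity, by field_simp, ?_⟩
      have e : p = ((β + γ) / (β + γ)) • p := by rw [div_self hpos.ne', one_smul]
      nth_rw 3 [e]
      linear_combination (norm := module) (1 / (β + γ)) • h0
    · obtain ⟨-, h1, h2⟩ := h (β + γ) β (-γ) hβ (by linarith)
        (by linear_combination (norm := module) h0)
      rcases hβγ with h3 | h3
      · exact h3 h1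
      · exact h3 (by linarith)
  rcases le_or_gt 0 β with hβ | hβ
  · exact key β γ hβ hβγ
  · intro h0
    refine key (-β) (-γ) (by linarith) (by simpa using hβγ) ?_
    linear_combination (norm := module) -h0

/-- A zero of `logArg` is a linear relation of the type excluded by `relation_ne_zero`; for I₄,
where c = u, `EdgeCone` alone excludes it. -/
lemma EdgeCone.logDefined {p : E3} (hp : p ∉ segment ℝ (p + v + u) (p + v + w)) (j : Fin 5) :
    LogDefined u v w j := by
  have hr := fun β γ => h.relation_ne_zero hp (β := β) (γ := γ)
  have hc := h.parC_ne_zero j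
  constructor <;> rw [logArg_pos_iff hc] <;> intro l hl h0 <;> fin_cases j <;>
    simp [parA, parB, parC] at h0
  · exact hr l 1 (by simp) (by linear_combination (norm := module) h0)
  · exact hr l 1 (by simp) (by linear_combination (norm := module) h0)
  · exact hr 1 l (by simp) (by linear_combination (norm := module) h0)
  · obtain ⟨h1, -⟩ := h 1 (1 + l) 0 (by linarith) le_rfl (by linear_combination (norm := module) h0)
    norm_num at h1
  · exact hr 1 l (by simp) (by linear_combination (norm := module) h0)
  · exact hr (l - 1) 1 (by simp) (by linear_combination (norm := module) h0)
  · exact hr (l - 1) 1 (by simp) (by linear_combination (norm := module) h0)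
  · exact hr 1 (l - 1) (by simp) (by linear_combination (norm := module) h0)
  · obtain ⟨h1, -⟩ := h 1 l 0 hl le_rfl (by linear_combination (norm := module) h0)
    norm_num at h1
  · exact hr 1 (l - 1) (by simp) (by linear_combination (norm := module) h0)

lemma EdgeCone.logDefined_of_regularPair {j : Fin 5} (hj : RegularPair u v w j) :
    LogDefined u v w j := by
  have hc := h.parC_ne_zero j
  have hsum : parA u v w j + parB u v w j - parC u v w j = parA' u v w j + parB' u v w j := by
    rw [parA', parB']; split_ifs <;> abel
  have h1 := (regular_iff hc).1 hj.1 1 (by simp)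
  have h2 := (regular_iff hc).1 hj.2 1 (by simp)
  rw [one_smul] at h1 h2
  exact ⟨h1, hsum ▸ h2⟩

theorem EdgeCone.edgeIntegral_eq_of_regularPair {j : Fin 5} (hj : RegularPair u v w j) :
    edgeIntegral u v w j = edgeFormula hIntegral u v w j := by
  have hc := h.parC_ne_zero j
  rw [h.edgeIntegral_eq (h.logDefined_of_regularPair hj), edgeFormula, edgeFormula,
    (hIntegral_of_regular hc hj.1).2, (hIntegral_of_regular hc hj.2).2]

lemma EdgeCone.regularPair (hl : LinearIndependent ℝ ![u, v, w]) (j : Fin 5) :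
    RegularPair u v w j := by
  have hc := h.parC_ne_zero j
  have hr : ∀ α β γ : ℝ, α • u + β • v + γ • w = 0 → α = 0 ∧ β = 0 ∧ γ = 0 := by
    intro α β γ h0
    have := Fintype.linearIndependent_iff.1 hl ![α, β, γ] (by simpa [Fin.sum_univ_three] using h0)
    exact ⟨this 0, this 1, this 2⟩
  constructor <;> rw [regular_iff hc] <;> intro η hη <;> rw [logArg_pos_iff hc] <;>
    intro l hl h0 <;> have h1 := hη.1 <;> fin_cases j <;>
    simp [parA', parB', parA, parB, parC] at h0
  · have := hr l (1 + l) η (by linear_combination (norm := module) h0); linarith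
  · have := hr l (η + l) 1 (by linear_combination (norm := module) h0); linarith
  · have := hr 1 (η + l) l (by linear_combination (norm := module) h0); linarith
  · have := hr (η + l) η (η - 1) (by linear_combination (norm := module) h0); linarith
  · have := hr η (η + l) (η - 1 + l) (by linear_combination (norm := module) h0); linarith
  · have := hr (l - 1) l η (by linear_combination (norm := module) h0); linarith
  · have := hr (l - η) l 1 (by linear_combination (norm := module) h0); linarith
  · have := hr 1 l (l - η) (by linear_combination (norm := module) h0); linarith
  · have := hr l η (η - 1) (by linear_combination (norm := module) h0); linarith
  · have := hr η l (l - 1) (by linear_combination (norm := module) h0); linarith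

end

/-! ### The surface measure of a triangle -/

/-- The linear part of the reference mapping. -/
noncomputable def chiLin (e f : E3) : EuclideanSpace ℝ (Fin 2) →ₗ[ℝ] E3 where
  toFun y := y 0 • e + y 1 • f
  map_add' x y := by simp; module
  map_smul' r x := by simp; module

lemma normDet_chiLin (e f : E3) : (chiLin e f).normDet = gramRoot e f := by
  have h := (chiLin e f).normDet_sq_eq_det_gram (EuclideanSpace.basisFun (Fin 2) ℝ)
  have h0 : chiLin e f (EuclideanSpace.basisFun (Fin 2) ℝ 0) = e := by simp [chiLin]
  have h1 : chiLin e f (EuclideanSpace.basisFun (Fin 2) ℝ 1) = f := by simp [chiLin]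
  rw [Matrix.det_fin_two] at h
  simp only [Matrix.gram_apply, h0, h1, real_inner_comm e f, real_inner_self_eq_norm_sq,
    RCLike.ofReal_real_eq_id, id] at h
  rw [gramRoot_eq, ← Real.sqrt_sq (chiLin e f).normDet_nonneg, h]
  congr 1
  ring

lemma continuous_chi (p e f : E3) : Continuous (chi p e f) := by
  unfold chi; fun_prop

lemma measurePreserving_coords :
    MeasurePreserving fun y : EuclideanSpace ℝ (Fin 2) => ((y 0, y 1) : ℝ × ℝ) :=
  (volume_preserving_finTwoArrow ℝ).comp (PiLp.volume_preserving_ofLp (Fin 2))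

/-- The linear part scales area by its `normDet`, and the translation by p is an isometry.
Injectivity is not needed. -/
lemma euclideanHausdorffMeasure_chi_image (p e f : E3) {A : Set (ℝ × ℝ)} (hA : MeasurableSet A) :
    (μHE[2] : Measure E3) (chi p e f '' A) = ENNReal.ofReal (gramRoot e f) * volume A := by
  have h := (chiLin e f).euclideanHausdorffMeasure_image_eq_normDet_mul_volume
    ((fun y : EuclideanSpace ℝ (Fin 2) => ((y 0, y 1) : ℝ × ℝ)) ⁻¹' A)
  rw [finrank_euclideanSpace_fin, normDet_chiLin,
    measurePreserving_coords.measure_preimage hA.nullMeasurableSet,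
    ← (isometry_add_left p).euclideanHausdorffMeasure_image] at h
  rw [← h]
  congr 1
  ext x
  simp only [mem_image, mem_preimage, exists_exists_and_eq_and]
  constructor
  · rintro ⟨z, hz, rfl⟩
    exact ⟨WithLp.toLp 2 ![z.1, z.2], by simpa using hz, by simp [chi, chiLin, add_assoc]⟩
  · rintro ⟨y, hy, rfl⟩
    exact ⟨_, hy, by simp [chi, chiLin, add_assoc]⟩

lemma measurableSet_refTriangle : MeasurableSet refTriangle := by
  exact (measurableSet_lt measurable_const measurable_fst).inter
    ((measurableSet_lt measurable_fst measurable_const).inter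
      ((measurableSet_lt measurable_const measurable_snd).inter
        (measurableSet_lt measurable_snd measurable_fst)))

lemma restrict_triangle (p e f : E3) : (μHE[2] : Measure E3).restrict (triangle p e f) =
    ENNReal.ofReal (gramRoot e f) • (volume.restrict refTriangle).map (chi p e f) := by
  have hm := (continuous_chi p e f).measurable
  ext s hs
  rw [Measure.restrict_apply hs, triangle, Measure.smul_apply, Measure.map_apply hm hs,
    Measure.restrict_apply (hm hs), inter_comm, ← image_inter_preimage,
    euclideanHausdorffMeasure_chi_image p e f (measurableSet_refTriangle.inter (hm hs)), inter_comm,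
    smul_eq_mul]

lemma lintegral_triangle (p e f : E3) {F : E3 → ENNReal} (hF : Measurable F) :
    ∫⁻ y in triangle p e f, F y ∂(μHE[2] : Measure E3) =
      ENNReal.ofReal (gramRoot e f) * ∫⁻ z in refTriangle, F (chi p e f z) := by
  rw [restrict_triangle, lintegral_smul_measure, lintegral_map hF (continuous_chi p e f).measurable,
    smul_eq_mul]

lemma volume_refTriangle_lt_top : volume refTriangle < ⊤ := by
  refine (measure_mono (t := Icc (0 : ℝ) 1 ×ˢ Icc (0 : ℝ) 1) fun z hz => ?_).trans_lt
    (isCompact_Icc.prod isCompact_Icc).measure_lt_top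
  obtain ⟨h1, h2, h3, h4⟩ := hz
  exact ⟨⟨h1.le, h2.le⟩, h3.le, by linarith⟩

lemma isFiniteMeasure_restrict_triangle (p e f : E3) :
    IsFiniteMeasure ((μHE[2] : Measure E3).restrict (triangle p e f)) := by
  constructor
  rw [← lintegral_one, lintegral_triangle p e f measurable_const, lintegral_one,
    Measure.restrict_apply_univ]
  exact ENNReal.mul_lt_top ENNReal.ofReal_lt_top volume_refTriangle_lt_top

/-! ### Integrals of homogeneous functions -/

lemma lintegral_smul_comp {V : Type*} [NormedAddCommGroup V] [NormedSpace ℝ V]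
    [FiniteDimensional ℝ V] [MeasurableSpace V] [BorelSpace V] (μ : Measure V)
    [μ.IsAddHaarMeasure] {g : V → ENNReal} (hg : Measurable g) {t : ℝ} (ht : 0 < t) :
    ∫⁻ v, g v ∂μ = ENNReal.ofReal (t ^ Module.finrank ℝ V) * ∫⁻ v, g (t • v) ∂μ := by
  rw [← lintegral_map hg (measurable_const_smul t), Measure.map_addHaar_smul μ ht.ne',
    lintegral_smul_measure, smul_eq_mul, ← mul_assoc, ← ENNReal.ofReal_mul (by positivity),
    abs_of_pos (by positivity), mul_inv_cancel₀ (by positivity), ENNReal.ofReal_one, one_mul]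

lemma lintegral_pow_Ioo (n : ℕ) :
    ∫⁻ t in Ioo (0 : ℝ) 1, ENNReal.ofReal (t ^ n) = ENNReal.ofReal (1 / (n + 1)) := by
  rw [← ofReal_integral_eq_lintegral_ofReal]
  · rw [← integral_Ioc_eq_integral_Ioo, ← intervalIntegral.integral_of_le zero_le_one]
    simp
  · exact ((continuous_pow n).integrableOn_Icc (a := 0) (b := 1)).mono_set Ioo_subset_Icc_self
  · filter_upwards [ae_restrict_mem measurableSet_Ioo] with t ht
    exact pow_nonneg ht.1.le n

/-- The integral of a function that is homogeneous of degree `-1` over a cone. -/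
lemma lintegral_cone {V : Type*} [NormedAddCommGroup V] [NormedSpace ℝ V]
    [FiniteDimensional ℝ V] [MeasurableSpace V] [BorelSpace V] (μ : Measure V)
    [μ.IsAddHaarMeasure] {n : ℕ} (hn : Module.finrank ℝ V = n + 1) {Ψ : ℝ → V → ENNReal}
    (hΨ : ∀ t, Measurable (Ψ t))
    (hom : ∀ t, 0 < t → ∀ v, Ψ t (t • v) = ENNReal.ofReal t⁻¹ * Ψ 1 v) :
    ∫⁻ t in Ioo (0 : ℝ) 1, ∫⁻ v, Ψ t v ∂μ =
      ENNReal.ofReal (1 / (n + 1)) * ∫⁻ v, Ψ 1 v ∂μ := by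
  -- Scaling by t contributes t^(n+1) and homogeneity t⁻¹; the remaining t^n integrates to 1/(n+1).
  rw [← lintegral_pow_Ioo, ← lintegral_mul_const _ (by fun_prop)]
  refine setLIntegral_congr_fun measurableSet_Ioo fun t ht => ?_
  have ht0 : 0 < t := ht.1
  rw [lintegral_smul_comp μ (hΨ t) ht0]
  simp_rw [hom t ht0]
  rw [lintegral_const_mul _ (hΨ 1), ← mul_assoc, ← ENNReal.ofReal_mul (by positivity), hn]
  congr 2
  field_simp
  ring

lemma measurableSet_unitSquare : MeasurableSet unitSquare :=
  measurableSet_Ioo.prod measurableSet_Ioo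

/-- The substitution of the unit square for the triangle. -/
lemma lintegral_triangle_eq_unitSquare {f : ℝ → ℝ → ENNReal}
    (hf : Measurable fun z : ℝ × ℝ => f z.1 z.2) :
    ∫⁻ t, ∫⁻ s, (if 0 < s ∧ s < t ∧ t < 1 then f t s else 0) =
      ∫⁻ z in unitSquare, ENNReal.ofReal z.1 * f z.1 (z.2 * z.1) := by
  have hm : Measurable fun z : ℝ × ℝ => ENNReal.ofReal z.1 * f z.1 (z.2 * z.1) :=
    (by fun_prop : Measurable fun z : ℝ × ℝ => ENNReal.ofReal z.1).mul
      (hf.comp (by fun_prop : Measurable fun z : ℝ × ℝ => (z.1, z.2 * z.1)))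
  have h1 : ∫⁻ z in unitSquare, ENNReal.ofReal z.1 * f z.1 (z.2 * z.1) =
      ∫⁻ t in Ioo (0 : ℝ) 1, ∫⁻ s in Ioo (0 : ℝ) 1, ENNReal.ofReal t * f t (s * t) := by
    rw [unitSquare, Measure.volume_eq_prod, ← Measure.prod_restrict,
      lintegral_prod _ hm.aemeasurable]
  rw [h1, ← lintegral_indicator measurableSet_Ioo]
  refine lintegral_congr fun t => ?_
  by_cases ht : t ∈ Ioo (0 : ℝ) 1
  · rw [indicator_of_mem ht]
    have hft : Measurable (f t) := hf.comp (by fun_prop : Measurable fun s : ℝ => (t, s))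
    have hg : Measurable fun s => if 0 < s ∧ s < t ∧ t < 1 then f t s else 0 := by
      refine Measurable.ite ?_ hft measurable_const
      exact (measurableSet_lt measurable_const measurable_id).inter
        ((measurableSet_lt measurable_id measurable_const).inter (MeasurableSet.const _))
    rw [lintegral_smul_comp volume hg ht.1, lintegral_const_mul (ENNReal.ofReal t)
        (f := fun s => f t (s * t)) (hft.comp (measurable_mul_const t)),
      ← lintegral_indicator measurableSet_Ioo]
    simp only [Module.finrank_self, pow_one]
    congr 1
    refine lintegral_congr fun s => ?_
    have h0 := ht.1
    by_cases hs : s ∈ Ioo (0 : ℝ) 1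
    · rw [indicator_of_mem hs, smul_eq_mul, if_pos ⟨mul_pos h0 hs.1, by nlinarith [hs.2], ht.2⟩,
        mul_comm]
    · rw [indicator_of_notMem hs, smul_eq_mul, if_neg]
      rintro ⟨h1, h2, -⟩
      exact hs ⟨pos_of_mul_pos_right h1 h0.le, by nlinarith⟩
  · rw [indicator_of_notMem ht, lintegral_eq_zero_iff' (by
      rw [show (fun s => if 0 < s ∧ s < t ∧ t < 1 then f t s else 0) = fun _ => 0 from ?_]
      · exact aemeasurable_const
      ext s
      rw [if_neg]
      rintro ⟨h1, h2, h3⟩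
      exact ht ⟨h1.trans h2, h3⟩)]
    refine ae_of_all _ fun s => ?_
    simp only [Pi.zero_apply]
    rw [if_neg]
    rintro ⟨h1, h2, h3⟩
    exact ht ⟨h1.trans h2, h3⟩

/-! ### The regularisation of the four-dimensional integral -/

lemma measurableSet_and {α : Type*} [MeasurableSpace α] {P Q : α → Prop}
    (hP : MeasurableSet {x | P x}) (hQ : MeasurableSet {x | Q x}) :
    MeasurableSet {x | P x ∧ Q x} := hP.inter hQ

section
variable {ψ : ℝ → ℝ → ℝ → ENNReal} (hψ : Measurable fun p : ℝ × ℝ × ℝ => ψ p.1 p.2.1 p.2.2)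
include hψ

lemma measurable_comp₃ {α : Type*} [MeasurableSpace α] {f g h : α → ℝ} (hf : Measurable f)
    (hg : Measurable g) (hh : Measurable h) : Measurable fun x => ψ (f x) (g x) (h x) :=
  hψ.comp (hf.prodMk (hg.prodMk hh))

variable (hom : ∀ t z y x, 0 < t → ψ (t * z) (t * y) (t * x) = ENNReal.ofReal t⁻¹ * ψ z y x)
include hom

/-- Reduction by the largest coordinate, which is the first one of the point `x`. -/
lemma lintegral_half_eq_three_dim :
    ∫⁻ x in refTriangle, ∫⁻ y in refTriangle,
      (if y.1 < x.1 then ψ (y.1 - x.1) y.2 x.2 else 0) =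
    ENNReal.ofReal (1 / 3) * ∫⁻ x, ∫⁻ y, ∫⁻ z,
      (if 0 < x ∧ x < 1 ∧ 0 < z ∧ z < y ∧ y < 1 then ψ (y - 1) z x else 0) := by
  -- Here t = x₁ and v = (x₂, y₁, y₂); on this half x₁ exceeds the other three coordinates.
  set Ψ : ℝ → ℝ × ℝ × ℝ → ENNReal := fun t v =>
    if 0 < v.1 ∧ v.1 < t ∧ 0 < v.2.2 ∧ v.2.2 < v.2.1 ∧ v.2.1 < t then
      ψ (v.2.1 - t) v.2.2 v.1 else 0 with hΨ
  have hm : Measurable fun p : ℝ × ℝ × ℝ × ℝ => Ψ p.1 p.2 := by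
    refine Measurable.ite ?_ (measurable_comp₃ hψ (by fun_prop) (by fun_prop) (by fun_prop))
      measurable_const
    refine measurableSet_and ?_ (measurableSet_and ?_ (measurableSet_and ?_
      (measurableSet_and ?_ ?_)))
    all_goals exact measurableSet_lt (by fun_prop) (by fun_prop)
  have hm1 : ∀ t, Measurable (Ψ t) := fun t => hm.comp measurable_prodMk_left
  have e1 : ∀ x : ℝ × ℝ, refTriangle.indicator (fun x => ∫⁻ y in refTriangle,
      (if y.1 < x.1 then ψ (y.1 - x.1) y.2 x.2 else 0)) x =
      ∫⁻ y, (Ioo (0 : ℝ) 1).indicator (fun t => Ψ t (x.2, y)) x.1 := by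
    intro x
    by_cases hx : x ∈ refTriangle
    · rw [indicator_of_mem hx, ← lintegral_indicator measurableSet_refTriangle]
      obtain ⟨h1, h2, h3, h4⟩ := hx
      refine lintegral_congr fun y => ?_
      rw [indicator_of_mem (show x.1 ∈ Ioo (0 : ℝ) 1 from ⟨h1, h2⟩)]
      by_cases hy : 0 < y.2 ∧ y.2 < y.1 ∧ y.1 < x.1
      · obtain ⟨h5, h6, h7⟩ := hy
        rw [indicator_of_mem (show y ∈ refTriangle from ⟨by linarith, by linarith, h5, h6⟩),
          if_pos h7, hΨ]
        exact (if_pos ⟨h3, h4, h5, h6, h7⟩).symm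
      · have : Ψ x.1 (x.2, y) = 0 := if_neg fun h => hy ⟨h.2.2.1, h.2.2.2.1, h.2.2.2.2⟩
        rw [this]
        by_cases hy' : y ∈ refTriangle
        · rw [indicator_of_mem hy', if_neg fun h => hy ⟨hy'.2.2.1, hy'.2.2.2, h⟩]
        · rw [indicator_of_notMem hy']
    · rw [indicator_of_notMem hx]
      symm
      refine (lintegral_congr fun y => ?_).trans lintegral_zero
      by_cases hx1 : x.1 ∈ Ioo (0 : ℝ) 1
      · rw [indicator_of_mem hx1]
        exact if_neg fun h => hx ⟨hx1.1, hx1.2, h.1, h.2.1⟩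
      · rw [indicator_of_notMem hx1]
  have hm2 : Measurable fun p : (ℝ × ℝ) × (ℝ × ℝ) =>
      (Ioo (0 : ℝ) 1).indicator (fun t => Ψ t (p.1.2, p.2)) p.1.1 := by
    have : (fun p : (ℝ × ℝ) × (ℝ × ℝ) =>
        (Ioo (0 : ℝ) 1).indicator (fun t => Ψ t (p.1.2, p.2)) p.1.1) =
        ((fun p : (ℝ × ℝ) × (ℝ × ℝ) => p.1.1) ⁻¹' Ioo (0 : ℝ) 1).indicator
          fun p => Ψ p.1.1 (p.1.2, p.2) := by
      ext p; simp [indicator]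
    rw [this]
    exact (hm.comp (by fun_prop : Measurable fun p : (ℝ × ℝ) × (ℝ × ℝ) =>
      (p.1.1, p.1.2, p.2))).indicator (measurableSet_Ioo.preimage (by fun_prop))
  rw [← lintegral_indicator measurableSet_refTriangle]
  simp_rw [e1]
  refine (lintegral_prod (μ := volume) (ν := volume) (fun x : ℝ × ℝ => ∫⁻ y : ℝ × ℝ,
    (Ioo (0 : ℝ) 1).indicator (fun t => Ψ t (x.2, y)) x.1)
    hm2.lintegral_prod_right'.aemeasurable).trans ?_
  have e2 : ∀ t : ℝ, ∫⁻ x2 : ℝ, ∫⁻ y : ℝ × ℝ,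
      (Ioo (0 : ℝ) 1).indicator (fun t => Ψ t (x2, y)) t =
      (Ioo (0 : ℝ) 1).indicator (fun t => ∫⁻ v, Ψ t v) t := by
    intro t
    by_cases ht : t ∈ Ioo (0 : ℝ) 1
    · simp only [indicator_of_mem ht]
      exact (lintegral_prod (μ := volume) (ν := volume) (Ψ t) (hm1 t).aemeasurable).symm
    · simp only [indicator_of_notMem ht, lintegral_zero]
  have : (volume : Measure (ℝ × ℝ × ℝ)).IsAddHaarMeasure :=
    Measure.prod.instIsAddHaarMeasure volume volume
  have e3 := lintegral_cone (V := ℝ × ℝ × ℝ) volume (n := 2) (by simp) (Ψ := Ψ) hm1 (by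
    intro t ht v
    have h1 : ∀ r : ℝ, 0 < t * r ↔ 0 < r := fun r => mul_pos_iff_of_pos_left ht
    have h2 : ∀ r s : ℝ, t * r < t * s ↔ r < s := fun r s => mul_lt_mul_iff_right₀ ht
    have h3 : ∀ r : ℝ, t * r < t ↔ r < 1 := fun r => by
      simpa using h2 r 1
    simp only [hΨ, Prod.smul_fst, Prod.smul_snd, smul_eq_mul, h1, h2, h3]
    rw [show t * v.2.1 - t = t * (v.2.1 - 1) by ring, hom _ _ _ _ ht]
    split_ifs <;> simp)
  rw [lintegral_congr e2, lintegral_indicator measurableSet_Ioo, e3]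
  norm_num only
  congr 1
  refine (lintegral_prod (μ := volume) (ν := volume) (Ψ 1) (hm1 1).aemeasurable).trans ?_
  exact lintegral_congr fun x => lintegral_prod (μ := volume) (ν := volume) (fun p => Ψ 1 (x, p))
    ((hm1 1).comp measurable_prodMk_left).aemeasurable

/-- Replacing y by 1 − y and then z by T − y gives the integrand ψ(−y, T−y, x) on 0 < x < 1, 0 < y <
T < 1, to which scaling applies again. Where T > x (part A) the cross-section is a square; where x >
T (part B) it is a triangle, which is mapped to the square. -/
lemma lintegral_three_dim :
    ∫⁻ x, ∫⁻ y, ∫⁻ z, (if 0 < x ∧ x < 1 ∧ 0 < z ∧ z < y ∧ y < 1 then ψ (y - 1) z x else 0) =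
      ENNReal.ofReal (1 / 2) * ((∫⁻ z in unitSquare, ψ (-z.1) (1 - z.1) z.2) +
        ∫⁻ z in unitSquare, ENNReal.ofReal z.1 * ψ (-(z.2 * z.1)) (z.1 - z.2 * z.1) 1) := by
  set A : ℝ → ℝ × ℝ → ENNReal := fun T p =>
    if 0 < p.1 ∧ p.1 < T ∧ 0 < p.2 ∧ p.2 < T then ψ (-p.2) (T - p.2) p.1 else 0 with hA
  set B : ℝ → ℝ × ℝ → ENNReal := fun X p =>
    if 0 < p.1 ∧ p.1 < p.2 ∧ p.2 < X then ψ (-p.1) (p.2 - p.1) X else 0 with hB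
  have mA : Measurable fun q : ℝ × ℝ × ℝ => A q.1 q.2 := by
    refine Measurable.ite ?_ (measurable_comp₃ hψ (by fun_prop) (by fun_prop) (by fun_prop))
      measurable_const
    refine measurableSet_and ?_ (measurableSet_and ?_ (measurableSet_and ?_ ?_))
    all_goals exact measurableSet_lt (by fun_prop) (by fun_prop)
  have mB : Measurable fun q : ℝ × ℝ × ℝ => B q.1 q.2 := by
    refine Measurable.ite ?_ (measurable_comp₃ hψ (by fun_prop) (by fun_prop) (by fun_prop))
      measurable_const
    refine measurableSet_and ?_ (measurableSet_and ?_ ?_)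
    all_goals exact measurableSet_lt (by fun_prop) (by fun_prop)
  have mA1 : ∀ t, Measurable (A t) := fun t => mA.comp measurable_prodMk_left
  have mB1 : ∀ t, Measurable (B t) := fun t => mB.comp measurable_prodMk_left
  set a : ℝ × ℝ × ℝ → ENNReal := fun v =>
    (Ioo (0 : ℝ) 1).indicator (fun T => A T (v.1, v.2.1)) v.2.2 with ha
  set b : ℝ × ℝ × ℝ → ENNReal := fun v =>
    (Ioo (0 : ℝ) 1).indicator (fun X => B X v.2) v.1 with hb
  have ma : Measurable a := by
    have : a = ((fun v : ℝ × ℝ × ℝ => v.2.2) ⁻¹' Ioo (0 : ℝ) 1).indicator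
        fun v => A v.2.2 (v.1, v.2.1) := by
      ext v; simp [ha, indicator]
    rw [this]
    exact (mA.comp (by fun_prop : Measurable fun v : ℝ × ℝ × ℝ => (v.2.2, v.1, v.2.1))).indicator
      (measurableSet_Ioo.preimage (by fun_prop))
  have mb : Measurable b := by
    have : b = ((fun v : ℝ × ℝ × ℝ => v.1) ⁻¹' Ioo (0 : ℝ) 1).indicator fun v => B v.1 v.2 := by
      ext v; simp [hb, indicator]
    rw [this]
    exact mB.indicator (measurableSet_Ioo.preimage (by fun_prop))
  have iter : ∀ F : ℝ × ℝ × ℝ → ENNReal, Measurable F →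
      ∫⁻ v, F v = ∫⁻ x, ∫⁻ y, ∫⁻ z, F (x, y, z) := by
    intro F hF
    refine (lintegral_prod (μ := volume) (ν := volume) F hF.aemeasurable).trans ?_
    exact lintegral_congr fun x => lintegral_prod (μ := volume) (ν := volume) (fun p => F (x, p))
      (hF.comp measurable_prodMk_left).aemeasurable
  have e1 : ∀ x : ℝ, ∫⁻ y, ∫⁻ z,
      (if 0 < x ∧ x < 1 ∧ 0 < z ∧ z < y ∧ y < 1 then ψ (y - 1) z x else 0) =
      ∫⁻ y, ∫⁻ T, (a (x, y, T) + b (x, y, T)) := by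
    intro x
    rw [← lintegral_sub_left_eq_self _ 1]
    refine lintegral_congr fun y => ?_
    rw [← lintegral_sub_right_eq_self _ y]
    refine lintegral_congr_ae ?_
    filter_upwards [measure_eq_zero_iff_ae_notMem.1 (measure_singleton (μ := volume) x)] with T hT
    simp only [ha, hb, hA, hB, indicator, mem_Ioo]
    rw [show 1 - y - 1 = -y by ring]
    rcases lt_or_gt_of_ne (show T ≠ x from hT) with h | h
    · rw [← ite_and, ← ite_and,
        if_neg (c := (0 < T ∧ T < 1) ∧ _) (fun h' => by linarith [h'.2.2.1]), zero_add]
      congr 1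
      refine propext ⟨fun ⟨h1, h2, h3, h4, h5⟩ => ⟨⟨h1, h2⟩, by linarith, by linarith, h⟩,
        fun ⟨⟨h1, h2⟩, h3, h4, h5⟩ => ⟨h1, h2, by linarith, by linarith, by linarith⟩⟩
    · rw [← ite_and, ← ite_and,
        if_neg (c := (0 < x ∧ x < 1) ∧ _) (fun h' => by linarith [h'.2.2.2]), add_zero]
      congr 1
      refine propext ⟨fun ⟨h1, h2, h3, h4, h5⟩ => ⟨⟨by linarith, by linarith⟩, h1, h, by linarith,
        by linarith⟩, fun ⟨⟨h1, h2⟩, h3, h4, h5, h6⟩ => ⟨h3, by linarith, by linarith,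
          by linarith, by linarith⟩⟩
  have ea : ∫⁻ v, a v = ENNReal.ofReal (1 / 2) * ∫⁻ z in unitSquare, ψ (-z.1) (1 - z.1) z.2 := by
    rw [iter a ma]
    have m1 : Measurable fun p : ℝ × ℝ => ∫⁻ T, a (p.1, p.2, T) :=
      (ma.comp (by fun_prop : Measurable fun q : (ℝ × ℝ) × ℝ =>
        (q.1.1, q.1.2, q.2))).lintegral_prod_right'
    rw [← lintegral_prod (μ := volume) (ν := volume) (fun p : ℝ × ℝ => ∫⁻ T, a (p.1, p.2, T))
        m1.aemeasurable, lintegral_lintegral_swap (f := fun p : ℝ × ℝ => fun T => a (p.1, p.2, T))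
        (ma.comp (by fun_prop : Measurable
          fun q : (ℝ × ℝ) × ℝ => (q.1.1, q.1.2, q.2))).aemeasurable]
    have e2 : ∀ T, ∫⁻ p : ℝ × ℝ, a (p.1, p.2, T) ∂(volume.prod volume) =
        (Ioo (0 : ℝ) 1).indicator (fun T => ∫⁻ p, A T p) T := by
      intro T
      by_cases hT : T ∈ Ioo (0 : ℝ) 1
      · simp only [ha, indicator_of_mem hT]; rfl
      · simp only [ha, indicator_of_notMem hT, lintegral_zero]
    rw [lintegral_congr e2, lintegral_indicator measurableSet_Ioo,
      lintegral_cone (V := ℝ × ℝ) volume (n := 1) (by simp) mA1 (by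
        intro t ht v
        have h1 : ∀ r : ℝ, 0 < t * r ↔ 0 < r := fun r => mul_pos_iff_of_pos_left ht
        have h3 : ∀ r : ℝ, t * r < t ↔ r < 1 := fun r => by
          simpa using (mul_lt_mul_iff_right₀ ht : t * r < t * 1 ↔ r < 1)
        simp only [hA, Prod.smul_fst, Prod.smul_snd, smul_eq_mul, h1, h3]
        rw [show t - t * v.2 = t * (1 - v.2) by ring, ← mul_neg, hom _ _ _ _ ht]
        split_ifs <;> simp)]
    norm_num only
    congr 1
    rw [← lintegral_indicator measurableSet_unitSquare, Measure.volume_eq_prod,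
      ← lintegral_prod_swap]
    refine lintegral_congr fun z => ?_
    simp only [hA, indicator, unitSquare, mem_prod, mem_Ioo, Prod.fst_swap, Prod.snd_swap]
    congr 1
    exact propext ⟨fun ⟨h1, h2, h3, h4⟩ => ⟨⟨h3, h4⟩, h1, h2⟩,
      fun ⟨⟨h3, h4⟩, h1, h2⟩ => ⟨h1, h2, h3, h4⟩⟩
  have eb : ∫⁻ v, b v = ENNReal.ofReal (1 / 2) *
      ∫⁻ z in unitSquare, ENNReal.ofReal z.1 * ψ (-(z.2 * z.1)) (z.1 - z.2 * z.1) 1 := by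
    rw [Measure.volume_eq_prod ℝ (ℝ × ℝ), lintegral_prod _ mb.aemeasurable]
    have e2 : ∀ X, ∫⁻ p : ℝ × ℝ, b (X, p) =
        (Ioo (0 : ℝ) 1).indicator (fun X => ∫⁻ p, B X p) X := by
      intro X
      by_cases hX : X ∈ Ioo (0 : ℝ) 1
      · simp only [hb, indicator_of_mem hX]
      · simp only [hb, indicator_of_notMem hX, lintegral_zero]
    rw [lintegral_congr e2, lintegral_indicator measurableSet_Ioo,
      lintegral_cone (V := ℝ × ℝ) volume (n := 1) (by simp) mB1 (by
        intro t ht v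
        have h1 : ∀ r : ℝ, 0 < t * r ↔ 0 < r := fun r => mul_pos_iff_of_pos_left ht
        have h2 : ∀ r s : ℝ, t * r < t * s ↔ r < s := fun r s => mul_lt_mul_iff_right₀ ht
        have h3 : ∀ r : ℝ, t * r < t ↔ r < 1 := fun r => by simpa using h2 r 1
        simp only [hB, Prod.smul_fst, Prod.smul_snd, smul_eq_mul, h1, h2, h3]
        rw [← mul_sub, ← mul_neg]
        have h4 := hom t (-v.1) (v.2 - v.1) 1 ht
        rw [mul_one] at h4
        rw [h4]
        split_ifs <;> simp)]
    norm_num only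
    congr 1
    rw [← lintegral_triangle_eq_unitSquare (f := fun t s => ψ (-s) (t - s) 1)
        (measurable_comp₃ hψ (by fun_prop) (by fun_prop) (by fun_prop)),
      Measure.volume_eq_prod, lintegral_prod_symm _ (mB1 1).aemeasurable]
  simp_rw [e1]
  rw [← iter (fun v => a v + b v) (ma.add mb), lintegral_add_left ma, ea, eb, mul_add]

lemma lintegral_half :
    ∫⁻ x in refTriangle, ∫⁻ y in refTriangle,
      (if y.1 < x.1 then ψ (y.1 - x.1) y.2 x.2 else 0) =
    ENNReal.ofReal (1 / 6) * ((∫⁻ z in unitSquare, ψ (-z.1) (1 - z.1) z.2) +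
        ∫⁻ z in unitSquare, ENNReal.ofReal z.1 * ψ (-(z.2 * z.1)) (z.1 - z.2 * z.1) 1) := by
  rw [lintegral_half_eq_three_dim hψ hom, lintegral_three_dim hψ hom, ← mul_assoc,
    ← ENNReal.ofReal_mul (by positivity)]
  norm_num

omit hom in
-- The square is cut along its diagonal and each half is parametrised by the square again. This
-- produces the terms of I₄ and I₅.
lemma lintegral_unitSquare_split : ∫⁻ z in unitSquare, ψ z.1 z.2 (1 - z.1) =
    (∫⁻ z in unitSquare, ENNReal.ofReal z.1 * ψ z.1 (z.2 * z.1) (1 - z.1)) +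
    ∫⁻ z in unitSquare, ENNReal.ofReal z.1 * ψ (z.2 * z.1) z.1 (1 - z.2 * z.1) := by
  have m1 : Measurable fun z : ℝ × ℝ => ψ z.1 z.2 (1 - z.1) :=
    measurable_comp₃ hψ (by fun_prop) (by fun_prop) (by fun_prop)
  have m2 : Measurable fun z : ℝ × ℝ => ψ z.2 z.1 (1 - z.2) :=
    measurable_comp₃ hψ (by fun_prop) (by fun_prop) (by fun_prop)
  have m3 : Measurable fun z : ℝ × ℝ => if 0 < z.2 ∧ z.2 < z.1 ∧ z.1 < 1 then
      ψ z.1 z.2 (1 - z.1) else 0 := by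
    refine Measurable.ite ?_ m1 measurable_const
    refine measurableSet_and ?_ (measurableSet_and ?_ ?_)
    all_goals exact measurableSet_lt (by fun_prop) (by fun_prop)
  have m4 : Measurable fun z : ℝ × ℝ => if 0 < z.1 ∧ z.1 < z.2 ∧ z.2 < 1 then
      ψ z.1 z.2 (1 - z.1) else 0 := by
    refine Measurable.ite ?_ m1 measurable_const
    refine measurableSet_and ?_ (measurableSet_and ?_ ?_)
    all_goals exact measurableSet_lt (by fun_prop) (by fun_prop)
  rw [← lintegral_triangle_eq_unitSquare (f := fun t s => ψ t s (1 - t)) m1,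
    ← lintegral_triangle_eq_unitSquare (f := fun t s => ψ s t (1 - s)) m2,
    ← lintegral_prod _ m3.aemeasurable, ← lintegral_prod_symm _ m4.aemeasurable,
    ← lintegral_add_left m3, ← lintegral_indicator measurableSet_unitSquare,
    Measure.volume_eq_prod, lintegral_prod _ (m1.indicator measurableSet_unitSquare).aemeasurable,
    lintegral_prod]
  swap
  · exact (m3.add m4).aemeasurable
  refine lintegral_congr fun t => lintegral_congr_ae ?_
  filter_upwards [measure_eq_zero_iff_ae_notMem.1 (measure_singleton (μ := volume) t)] with s hs
  simp only [indicator, unitSquare, mem_prod, mem_Ioo]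
  rcases lt_or_gt_of_ne (show s ≠ t from hs) with h | h
  · rw [if_neg (c := 0 < t ∧ t < s ∧ s < 1) (fun h' => by linarith [h'.2.1]), add_zero]
    congr 1
    exact propext ⟨fun ⟨⟨h1, h2⟩, h3, h4⟩ => ⟨h3, h, h2⟩,
      fun ⟨h1, h2, h3⟩ => ⟨⟨by linarith, h3⟩, h1, by linarith⟩⟩
  · rw [if_neg (c := 0 < s ∧ s < t ∧ t < 1) (fun h' => by linarith [h'.2.1]), zero_add]
    congr 1
    exact propext ⟨fun ⟨⟨h1, h2⟩, h3, h4⟩ => ⟨h1, h, h4⟩,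
      fun ⟨h1, h2, h3⟩ => ⟨⟨h1, by linarith⟩, by linarith, h3⟩⟩

/-- The integral over a pair of triangles of a function that is homogeneous of degree `-1` in the
relative coordinates. -/
theorem lintegral_refTriangle_pair :
    ∫⁻ x in refTriangle, ∫⁻ y in refTriangle, ψ (y.1 - x.1) y.2 x.2 =
    ENNReal.ofReal (1 / 6) * ((∫⁻ z in unitSquare, ψ (-z.1) (1 - z.1) z.2) +
      (∫⁻ z in unitSquare, ENNReal.ofReal z.1 * ψ (-(z.2 * z.1)) (z.1 - z.2 * z.1) 1) +
      (∫⁻ z in unitSquare, ENNReal.ofReal z.1 * ψ (z.2 * z.1) 1 (z.1 - z.2 * z.1)) +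
      (∫⁻ z in unitSquare, ENNReal.ofReal z.1 * ψ z.1 (z.2 * z.1) (1 - z.1)) +
      ∫⁻ z in unitSquare, ENNReal.ofReal z.1 * ψ (z.2 * z.1) z.1 (1 - z.2 * z.1)) := by
  have h1 := lintegral_half hψ hom
  -- Exchanging the two points, which replaces ψ(z,y,x) by ψ(−z,x,y), reduces the half x₁ < y₁ to
  -- the other one.
  have h2 := lintegral_half (ψ := fun z y x => ψ (-z) x y)
    (measurable_comp₃ hψ (by fun_prop) (by fun_prop) (by fun_prop))
    (fun t z y x ht => by rw [← mul_neg, hom _ _ _ _ ht])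
  simp only [neg_neg, neg_sub] at h2
  rw [lintegral_unitSquare_split hψ] at h2
  have m0 : Measurable fun p : (ℝ × ℝ) × (ℝ × ℝ) => ψ (p.2.1 - p.1.1) p.2.2 p.1.2 :=
    measurable_comp₃ hψ (by fun_prop) (by fun_prop) (by fun_prop)
  have m1 : Measurable fun p : (ℝ × ℝ) × (ℝ × ℝ) =>
      if p.2.1 < p.1.1 then ψ (p.2.1 - p.1.1) p.2.2 p.1.2 else 0 :=
    Measurable.ite (measurableSet_lt (by fun_prop) (by fun_prop)) m0 measurable_const
  have m2 : Measurable fun p : (ℝ × ℝ) × (ℝ × ℝ) =>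
      if p.1.1 < p.2.1 then ψ (p.2.1 - p.1.1) p.2.2 p.1.2 else 0 :=
    Measurable.ite (measurableSet_lt (by fun_prop) (by fun_prop)) m0 measurable_const
  rw [lintegral_lintegral_swap (f := fun x y : ℝ × ℝ =>
    if y.1 < x.1 then ψ (x.1 - y.1) x.2 y.2 else 0) (m2.comp measurable_swap).aemeasurable] at h2
  have e : ∀ x : ℝ × ℝ, ∫⁻ y in refTriangle, ψ (y.1 - x.1) y.2 x.2 =
      (∫⁻ y in refTriangle, (if y.1 < x.1 then ψ (y.1 - x.1) y.2 x.2 else 0)) +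
      ∫⁻ y in refTriangle, (if x.1 < y.1 then ψ (y.1 - x.1) y.2 x.2 else 0) := by
    intro x
    rw [← lintegral_add_left (f := fun y : ℝ × ℝ =>
      if y.1 < x.1 then ψ (y.1 - x.1) y.2 x.2 else 0) (m1.comp measurable_prodMk_left)]
    refine lintegral_congr_ae (ae_restrict_of_ae ?_)
    have : ∀ᵐ y : ℝ × ℝ, y.1 ≠ x.1 :=
      Measure.quasiMeasurePreserving_fst.ae
        (measure_eq_zero_iff_ae_notMem.1 (measure_singleton (μ := volume) x.1))
    filter_upwards [this] with y hy
    rcases lt_or_gt_of_ne hy with h | h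
    · rw [if_pos h, if_neg h.not_gt, add_zero]
    · rw [if_pos h, if_neg h.not_gt, zero_add]
  simp_rw [e]
  rw [lintegral_add_left m1.lintegral_prod_right', h1, h2, ← mul_add]
  congr 1
  ring

end

/-! ### The single layer integral -/

lemma fundSol_nonneg (x y : E3) : 0 ≤ fundSol x y := by
  have := Real.pi_pos
  unfold fundSol; positivity

lemma measurable_fundSol : Measurable fun z : E3 × E3 => fundSol z.1 z.2 := by
  unfold fundSol; fun_prop

lemma edgeIntegrand_nonneg (u v w : E3) (j : Fin 5) {z : ℝ × ℝ} (hz : z ∈ unitSquare) :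
    0 ≤ edgeIntegrand u v w j z := by
  have h0 : 0 < z.1 := hz.1.1
  fin_cases j <;> simp [edgeIntegrand] <;> positivity

lemma EdgeCone.lintegral_edgeIntegrand {u v w : E3} (h : EdgeCone u v w) (j : Fin 5) :
    ∫⁻ z in unitSquare, ENNReal.ofReal (edgeIntegrand u v w j z) =
      ENNReal.ofReal (edgeIntegral u v w j) := by
  rw [edgeIntegral, ofReal_integral_eq_lintegral_ofReal (h.integrableOn_edgeIntegrand j)]
  filter_upwards [ae_restrict_mem measurableSet_unitSquare] with z hz
  exact edgeIntegrand_nonneg u v w j hz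

lemma edgeIntegral_nonneg (u v w : E3) (j : Fin 5) : 0 ≤ edgeIntegral u v w j :=
  setIntegral_nonneg measurableSet_unitSquare fun _ hz => edgeIntegrand_nonneg u v w j hz

/-- The kernel in relative coordinates. -/
noncomputable def relKernel (u v w : E3) (z y x : ℝ) : ENNReal :=
  ENNReal.ofReal (1 / ‖z • v + y • u - x • w‖)

lemma measurable_relKernel (u v w : E3) :
    Measurable fun p : ℝ × ℝ × ℝ => relKernel u v w p.1 p.2.1 p.2.2 := by
  unfold relKernel; fun_prop

lemma relKernel_mul (u v w : E3) (t z y x : ℝ) (ht : 0 < t) :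
    relKernel u v w (t * z) (t * y) (t * x) = ENNReal.ofReal t⁻¹ * relKernel u v w z y x := by
  rw [relKernel, relKernel, ← ENNReal.ofReal_mul (by positivity), mul_smul, mul_smul, mul_smul,
    ← smul_add, ← smul_sub, norm_smul, Real.norm_of_nonneg ht.le]
  congr 1
  rw [one_div, mul_inv, one_div]

lemma EdgeCone.lintegral_relKernel {u v w : E3} (h : EdgeCone u v w) :
    ∫⁻ x in refTriangle, ∫⁻ y in refTriangle, relKernel u v w (y.1 - x.1) y.2 x.2 =
      ENNReal.ofReal (1 / 6 * ∑ j, edgeIntegral u v w j) := by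
  have hnn := edgeIntegral_nonneg u v w
  rw [lintegral_refTriangle_pair (measurable_relKernel u v w) (relKernel_mul u v w),
    ENNReal.ofReal_mul (by norm_num), ENNReal.ofReal_sum_of_nonneg fun j _ => hnn j]
  simp_rw [← h.lintegral_edgeIntegrand]
  rw [Fin.sum_univ_five]
  have key : ∀ (j : Fin 5) (F : ℝ × ℝ → ENNReal),
      (∀ z ∈ unitSquare, F z = ENNReal.ofReal (edgeIntegrand u v w j z)) →
      ∫⁻ z in unitSquare, F z = ∫⁻ z in unitSquare, ENNReal.ofReal (edgeIntegrand u v w j z) :=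
    fun j F hF => setLIntegral_congr_fun measurableSet_unitSquare hF
  have hmul : ∀ (z y x t : ℝ), 0 ≤ t → ENNReal.ofReal t * relKernel u v w z y x =
      ENNReal.ofReal (t / ‖z • v + y • u - x • w‖) := by
    intro z y x t ht
    rw [relKernel, ← ENNReal.ofReal_mul ht, mul_one_div]
  refine congrArg (ENNReal.ofReal (1 / 6) * ·) (congrArg₂ (· + ·) (congrArg₂ (· + ·)
    (congrArg₂ (· + ·) (congrArg₂ (· + ·) (key 0 _ fun z hz => ?_) (key 1 _ fun z hz => ?_))
      (key 2 _ fun z hz => ?_)) (key 3 _ fun z hz => ?_)) (key 4 _ fun z hz => ?_))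
  · simp only [relKernel, edgeIntegrand, Matrix.cons_val_zero]
    rw [← norm_neg]
    congr 3
    module
  · rw [hmul _ _ _ _ hz.1.1.le]
    simp only [edgeIntegrand, Matrix.cons_val_one, Matrix.cons_val_zero]
    rw [← norm_neg]
    congr 3
    module
  all_goals
    rw [hmul _ _ _ _ hz.1.1.le]
    simp only [edgeIntegrand, Matrix.cons_val]
    congr 3
    module

lemma ofReal_fundSol_chi (p u v w : E3) (x y : ℝ × ℝ) :
    ENNReal.ofReal (fundSol (chi p v w x) (chi p v u y)) =
      ENNReal.ofReal (1 / (4 * Real.pi)) * relKernel u v w (y.1 - x.1) y.2 x.2 := by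
  have := Real.pi_pos
  rw [relKernel, ← ENNReal.ofReal_mul (by positivity), fundSol, one_div_mul_one_div]
  congr 4
  unfold chi
  module

lemma gramRoot_nonneg (e f : E3) : 0 ≤ gramRoot e f := Real.sqrt_nonneg _

lemma EdgeCone.lintegral_fundSol {u v w : E3} (h : EdgeCone u v w) (p : E3) :
    ∫⁻ x in triangle p v w, ∫⁻ y in triangle p v u, ENNReal.ofReal (fundSol x y)
      ∂(μHE[2] : Measure E3) ∂(μHE[2] : Measure E3) =
    ENNReal.ofReal (gramRoot v u * gramRoot v w / (24 * Real.pi) * ∑ j, edgeIntegral u v w j) := by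
  have := isFiniteMeasure_restrict_triangle p v u
  have hm : Measurable fun z : E3 × E3 => ENNReal.ofReal (fundSol z.1 z.2) :=
    measurable_fundSol.ennreal_ofReal
  have hm1 : ∀ x : E3, Measurable fun y => ENNReal.ofReal (fundSol x y) := fun x => by
    unfold fundSol; fun_prop
  have hm2 : Measurable fun x : E3 => ∫⁻ y in triangle p v u, ENNReal.ofReal (fundSol x y)
      ∂(μHE[2] : Measure E3) := hm.lintegral_prod_right'
  have hr := measurable_relKernel u v w
  have hr1 : ∀ x : ℝ × ℝ, Measurable fun y : ℝ × ℝ => relKernel u v w (y.1 - x.1) y.2 x.2 :=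
    fun x => measurable_comp₃ hr (by fun_prop) (by fun_prop) (by fun_prop)
  have hr2 : Measurable fun q : (ℝ × ℝ) × (ℝ × ℝ) => relKernel u v w (q.2.1 - q.1.1) q.2.2 q.1.2 :=
    measurable_comp₃ hr (by fun_prop) (by fun_prop) (by fun_prop)
  have e : ∀ x : ℝ × ℝ, ∫⁻ y in triangle p v u, ENNReal.ofReal (fundSol (chi p v w x) y)
      ∂(μHE[2] : Measure E3) = ENNReal.ofReal (gramRoot v u) * (ENNReal.ofReal (1 / (4 * Real.pi)) *
        ∫⁻ y in refTriangle, relKernel u v w (y.1 - x.1) y.2 x.2) := by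
    intro x
    rw [lintegral_triangle p v u (hm1 (chi p v w x))]
    simp_rw [ofReal_fundSol_chi]
    rw [lintegral_const_mul _ (hr1 x)]
  rw [lintegral_triangle p v w hm2]
  simp_rw [e]
  have hm3 := hr2.lintegral_prod_right' (ν := volume.restrict refTriangle)
  rw [lintegral_const_mul _ (hm3.const_mul _), lintegral_const_mul _ hm3, h.lintegral_relKernel,
    ← ENNReal.ofReal_mul (by positivity), ← ENNReal.ofReal_mul (gramRoot_nonneg _ _),
    ← ENNReal.ofReal_mul (gramRoot_nonneg _ _)]
  -- The constant is (1/(4π))·(1/6) = 1/(24π).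
  congr 1
  field_simp
  ring

/-- The lower integral of the nonnegative kernel equals a finite real number, which gives
integrability; Fubini then identifies the iterated integral with that number. -/
theorem EdgeCone.integrable_fundSol {u v w : E3} (h : EdgeCone u v w) (p : E3) :
    Integrable (fun z : E3 × E3 => fundSol z.1 z.2)
      (((μHE[2] : Measure E3).restrict (triangle p v w)).prod
        ((μHE[2] : Measure E3).restrict (triangle p v u))) ∧
    singleLayer (triangle p v w) (triangle p v u) =
      gramRoot v u * gramRoot v w / (24 * Real.pi) * ∑ j, edgeIntegral u v w j := by
  have := isFiniteMeasure_restrict_triangle p v u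
  have := isFiniteMeasure_restrict_triangle p v w
  have hprod : ∫⁻ z, ENNReal.ofReal (fundSol z.1 z.2)
      ∂(((μHE[2] : Measure E3).restrict (triangle p v w)).prod
        ((μHE[2] : Measure E3).restrict (triangle p v u))) =
      ENNReal.ofReal
        (gramRoot v u * gramRoot v w / (24 * Real.pi) * ∑ j, edgeIntegral u v w j) := by
    rw [lintegral_prod _ measurable_fundSol.ennreal_ofReal.aemeasurable, h.lintegral_fundSol p]
  have hint : Integrable (fun z : E3 × E3 => fundSol z.1 z.2)
      (((μHE[2] : Measure E3).restrict (triangle p v w)).prod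
        ((μHE[2] : Measure E3).restrict (triangle p v u))) := by
    refine ⟨measurable_fundSol.aestronglyMeasurable, ?_⟩
    rw [hasFiniteIntegral_iff_ofReal (ae_of_all _ fun z => fundSol_nonneg _ _), hprod]
    exact ENNReal.ofReal_lt_top
  refine ⟨hint, ?_⟩
  have h1 : singleLayer (triangle p v w) (triangle p v u) = _ := (integral_prod _ hint).symm
  rw [h1, integral_eq_lintegral_of_nonneg_ae (ae_of_all _ fun z => fundSol_nonneg _ _)
    measurable_fundSol.aestronglyMeasurable, hprod, ENNReal.toReal_ofReal]
  have := gramRoot_nonneg v u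
  have := gramRoot_nonneg v w
  have := Finset.sum_nonneg fun j (_ : j ∈ Finset.univ) => edgeIntegral_nonneg u v w j
  have := Real.pi_pos
  positivity

end SingleLayerEdge

theorem mainTheorem2 :
    -- the closed form of `H(a, b, c) = ∫₀¹ h`
    (∀ a b c : E3, c ≠ 0 →
      (a ≠ 0 → 0 ≤ disc a b c) ∧
      (Regular a b c →
        IntervalIntegrable (hFun a b c) volume 0 1 ∧ hIntegral a b c = hClosed a b c)) ∧
    -- two triangles `τ`, `σ` whose intersection is exactly the common edge from `p` to `p + v`
    (∀ p u v w : E3, gramRoot v u ≠ 0 → gramRoot v w ≠ 0 →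
      closedTriangle p v u ∩ closedTriangle p v w = segment ℝ p (p + v) →
      -- the single layer integral
      (Integrable (fun z : E3 × E3 => fundSol z.1 z.2)
          (((μHE[2] : Measure E3).restrict (triangle p v w)).prod
            ((μHE[2] : Measure E3).restrict (triangle p v u))) ∧
        (∀ j, IntegrableOn (edgeIntegrand u v w j) unitSquare) ∧
        singleLayer (triangle p v w) (triangle p v u) =
          gramRoot v u * gramRoot v w / (24 * Real.pi) * ∑ j, edgeIntegral u v w j) ∧
      -- the closed form of the integrals `I_j`, wherever its logarithm is defined
      (∀ j, LogDefined u v w j → edgeIntegral u v w j = edgeFormula hClosed u v w j) ∧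
      -- the same formula with `H` as an integral, wherever its integrand has no pole
      (∀ j, RegularPair u v w j → edgeIntegral u v w j = edgeFormula hIntegral u v w j) ∧
      -- the logarithms are defined unless `p` lies between the two opposite vertices,
      -- and for triangles that are not coplanar there are no poles
      (p ∉ segment ℝ (p + v + u) (p + v + w) → ∀ j, LogDefined u v w j) ∧
      (LinearIndependent ℝ ![u, v, w] → ∀ j, RegularPair u v w j)) := by
  refine ⟨fun a b c hc => ⟨fun ha => disc_nonneg ha b hc, hIntegral_of_regular hc⟩, ?_⟩
  intro p u v w hu hw hint
  have h := edgeCone_of_inter hu hw hint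
  obtain ⟨h1, h2⟩ := h.integrable_fundSol p
  exact ⟨⟨h1, h.integrableOn_edgeIntegrand, h2⟩, fun _ => h.edgeIntegral_eq,
    fun _ => h.edgeIntegral_eq_of_regularPair, h.logDefined, h.regularPair⟩
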